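/- Let $n$ be a natural number, $M=\{1,\dots,n\}$, and let $M'=\{1',\dots,n'\}$ be a disjoint copy of $M$. Let $\mathfrak{C}_n$ be the monoid of all partitions of the set $M\cup M'$ into disjoint blocks, where the product $\alpha\beta$ is the composition of diagrams: identify each point $j'$ of $\alpha$ with the point $j$ of $\beta$, take the finest partition of the resulting three-layer set in which points joined in $\alpha$ or in $\beta$ lie together, and restrict it to the two outer layers. Let $\mathcal{IP}_n\subseteq\mathfrak{C}_n$ be the submonoid of the partitions all of whose blocks meet both $M$ and $M'$, and let $\mathcal{IT}_n\subseteq\mathcal{IP}_n$ be the submonoid of the partitions each of whose blocks $X$ meets both $M$ and $M'$ and satisfies $|X\cap M|=|X\cap M'|$. For $1\le i\le n-1$ let $s_i\in\mathcal{IT}_n$ be the partition with blocks $\{i,(i+1)'\}$, $\{i+1,i'\}$ and $\{j,j'\}$ for $j\ne i,i+1$, and let $\varrho_i\in\mathcal{IT}_n$ be the partition with blocks $\{i,i+1,i',(i+1)'\}$ and $\{j,j'\}$ for $j\neq i,i+1$. Let $T$ be the monoid with identity $e$ generated by $\sigma_i,\tau_i$ ($1\le i\le n-1$) subject to the relations,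 for $i,j\in\{1,\dots,n-1\}$, $$\sigma_i^2=e;\quad \sigma_i\sigma_j=\sigma_j\sigma_i\ (|i-j|>1);\quad \sigma_i\sigma_j\sigma_i=\sigma_j\sigma_i\sigma_j\ (|i-j|=1);$$ $$\tau_i^2=\tau_i;\quad \tau_i\tau_j=\tau_j\tau_i\ (i\neq j);$$ $$\tau_i\sigma_i=\sigma_i\tau_i=\tau_i;\quad \tau_i\sigma_j=\sigma_j\tau_i\ (|i-j|>1);$$ $$\sigma_i\tau_j\sigma_i=\sigma_j\tau_i\sigma_j\ \text{ and }\ \tau_i\sigma_j\tau_i=\tau_i\tau_j\ (|i-j|=1).$$ (1) The map $\sigma_i\mapsto s_i$, $\tau_i\mapsto\varrho_i$ ($1\le i\le n-1$) extends to an isomorphism $T\to\mathcal{IT}_n$. (2) Let $\mathcal{I}^*_M$ be the dual symmetric inverse monoid, that is, the set of all binary relations $R$ on $M$ with domain and range $M$ that are difunctional ($R\circ R^{-1}\circ R\subseteq R$), where the product of two relations is the smallest difunctional relation containing their composite. The map $\alpha\mapsto\{(i,j)\in M\times M : i \text{ and } j' \text{ lie in the same block of } \alpha\}$ is an isomorphism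 $\mathcal{IP}_n\to\mathcal{I}^*_M$, and the image of $\mathcal{IT}_n$ under it is the greatest (with respect to inclusion) factorizable inverse submonoid of $\mathcal{I}^*_M$. Here a monoid is inverse if every element $x$ has exactly one $y$ with $xyx=x$ and $yxy=y$, and it is factorizable if each of its elements is the product of an idempotent and a unit. -/

import Mathlib

namespace BrauerType

/-! ### Auxiliary facts on equivalence relations -/

theorem map_le {A B : Type*} {r : Setoid A} {f : A → B} {s : Setoid B} :
    r.map f ≤ s ↔ r ≤ s.comap f := by
  constructor
  · intro h a b hab
    exact h (Relation.EqvGen.rel _ _ ⟨a, b, hab, rfl, rfl⟩)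
  · intro h
    refine Setoid.eqvGen_le ?_
    rintro _ _ ⟨a, b, hab, rfl, rfl⟩
    exact h hab

theorem le_comap_map {A B : Type*} (r : Setoid A) (f : A → B) : r ≤ (r.map f).comap f :=
  map_le.1 le_rfl

theorem map_sup {A B : Type*} (r s : Setoid A) (f : A → B) :
    (r ⊔ s).map f = r.map f ⊔ s.map f := by
  apply le_antisymm
  · rw [map_le]
    exact sup_le (map_le.1 le_sup_left) (map_le.1 le_sup_right)
  · exact sup_le (map_le.2 (le_sup_left.trans (le_comap_map _ _)))
      (map_le.2 (le_sup_right.trans (le_comap_map _ _)))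

theorem map_map {A B C : Type*} (r : Setoid A) (f : A → B) (g : B → C) :
    (r.map f).map g = r.map (g ∘ f) :=
  le_antisymm
    (map_le.2 (map_le.2 (show r ≤ (r.map (g ∘ f)).comap (g ∘ f) from le_comap_map _ _)))
    (map_le.2 (fun {_ _} h => le_comap_map (r.map f) g (le_comap_map r f h)))

theorem comap_sup_map {W V : Type*} (f : W → V) (r : Setoid V) (s : Setoid W) :
    (r ⊔ s.map f).comap f = r.comap f ⊔ s := by
  apply le_antisymm
  · let q : Setoid V :=
      { r := fun x y => r x y ∨ ∃ a b, r x (f a) ∧ (r.comap f ⊔ s) a b ∧ r (f b) y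
        iseqv :=
          { refl := fun x => Or.inl (r.refl x)
            symm := by
              rintro x y (h | ⟨a, b, h1, h2, h3⟩)
              · exact Or.inl (r.symm h)
              · exact Or.inr ⟨b, a, r.symm h3, Setoid.symm' _ h2, r.symm h1⟩
            trans := by
              rintro x y z (h | ⟨a, b, h1, h2, h3⟩) (k | ⟨c, d, k1, k2, k3⟩)
              · exact Or.inl (r.trans h k)
              · exact Or.inr ⟨c, d, r.trans h k1, k2, k3⟩
              · exact Or.inr ⟨a, b, h1, h2, r.trans h3 k⟩
              · have hbc : (r.comap f ⊔ s) b c :=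
                  (le_sup_left : r.comap f ≤ r.comap f ⊔ s) (r.trans h3 k1)
                exact Or.inr ⟨a, d, h1, Setoid.trans' _ (Setoid.trans' _ h2 hbc) k2, k3⟩ } }
    have hq : r ⊔ s.map f ≤ q := by
      refine sup_le (fun {_ _} h => Or.inl h) (map_le.2 ?_)
      intro a b h
      exact Or.inr ⟨a, b, r.refl _, (le_sup_right : s ≤ r.comap f ⊔ s) h, r.refl _⟩
    intro x y h
    rcases hq h with h | ⟨a, b, h1, h2, h3⟩
    · exact (le_sup_left : r.comap f ≤ r.comap f ⊔ s) h
    · have l : r.comap f ≤ r.comap f ⊔ s := le_sup_left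
      exact Setoid.trans' _ (Setoid.trans' _ (l h1) h2) (l h3)
  · refine sup_le ?_ ?_
    · intro x y h
      exact (le_sup_left : r ≤ r ⊔ s.map f) h
    · exact map_le.1 le_sup_right

theorem comap_map_square {U A W V : Type*} (h : U → W) (o : U → A) (f : W → V) (g : A → V)
    (hf : Function.Injective f) (hg : Function.Injective g)
    (hc : ∀ u, f (h u) = g (o u))
    (hp : ∀ w a, f w = g a → ∃ u, h u = w ∧ o u = a) (r : Setoid A) :
    (r.map g).comap f = (r.comap o).map h := by
  have hk : Setoid.ker g ≤ r := by
    intro a b hab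
    rw [hg hab]
  apply le_antisymm
  · intro x y hxy
    have hxy' : (r.map g) (f x) (f y) := hxy
    rw [Setoid.coe_map_of_ker_le r g hk] at hxy'
    rcases hxy' with ⟨a, b, hab, ha, hb⟩ | he
    · obtain ⟨u, rfl, rfl⟩ := hp x a ha.symm
      obtain ⟨v, rfl, rfl⟩ := hp y b hb.symm
      exact le_comap_map (r.comap o) h hab
    · rw [hf he]
  · rw [map_le]
    intro u v huv
    have : (r.map g) (g (o u)) (g (o v)) :=
      le_comap_map r g huv
    rw [← hc, ← hc] at this
    exact this

/-! ### Composition of diagrams -/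

/-- The composition of a diagram `α` with left pins `A` and right pins `B` with a diagram `β`
with left pins `B` and right pins `C`.  The three-layer set is `A ⊕ (B ⊕ C)`: the right pins of
`α` are identified with the left pins of `β`, the connections of `α` and of `β` generate an
equivalence relation on the three layers, and this relation is restricted to the outer layers. -/
def comp {A B C : Type*} (α : Setoid (A ⊕ B)) (β : Setoid (B ⊕ C)) : Setoid (A ⊕ C) :=
  (α.map (Sum.map id Sum.inl : A ⊕ B → A ⊕ (B ⊕ C)) ⊔
    β.map (Sum.inr : B ⊕ C → A ⊕ (B ⊕ C))).comap (Sum.map id Sum.inr : A ⊕ C → A ⊕ (B ⊕ C))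

theorem comp_assoc {A B C D : Type*} (α : Setoid (A ⊕ B)) (β : Setoid (B ⊕ C))
    (γ : Setoid (C ⊕ D)) : comp (comp α β) γ = comp α (comp β γ) := by
  have e1 : (comp α β).map (Sum.map id Sum.inl : A ⊕ C → A ⊕ (C ⊕ D)) =
      ((α.map (Sum.map id Sum.inl : A ⊕ B → A ⊕ (B ⊕ C)) ⊔
        β.map (Sum.inr : B ⊕ C → A ⊕ (B ⊕ C))).map
          (Sum.map id (Sum.map id Sum.inl) : A ⊕ (B ⊕ C) → A ⊕ (B ⊕ (C ⊕ D)))).comap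
        (Sum.map id Sum.inr : A ⊕ (C ⊕ D) → A ⊕ (B ⊕ (C ⊕ D))) := by
    refine (comap_map_square _ _ _ _ ?_ ?_ ?_ ?_ _).symm
    · rintro (a | a) (b | b) h <;> simp_all
    · rintro (a | a | a) (b | b | b) h <;> simp_all
    · rintro (a | a) <;> rfl
    · rintro (a | c | d) (a' | b' | c') h <;> simp_all
  have e2 : (comp β γ).map (Sum.inr : B ⊕ D → A ⊕ (B ⊕ D)) =
      ((β.map (Sum.map id Sum.inl : B ⊕ C → B ⊕ (C ⊕ D)) ⊔
        γ.map (Sum.inr : C ⊕ D → B ⊕ (C ⊕ D))).map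
          (Sum.inr : B ⊕ (C ⊕ D) → A ⊕ (B ⊕ (C ⊕ D)))).comap
        (Sum.map id (Sum.map id Sum.inr) : A ⊕ (B ⊕ D) → A ⊕ (B ⊕ (C ⊕ D))) := by
    refine (comap_map_square _ _ _ _ ?_ ?_ ?_ ?_ _).symm
    · rintro (a | a | a) (b | b | b) h <;> simp_all
    · rintro (a | a | a) (b | b | b) h <;> simp_all
    · rintro (a | a) <;> rfl
    · rintro (a | c | d) (a' | b' | c') h <;> simp_all
  have l : comp (comp α β) γ =
      ((α.map (Sum.map id Sum.inl : A ⊕ B → A ⊕ (B ⊕ (C ⊕ D))) ⊔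
        β.map (Sum.inr ∘ Sum.map id Sum.inl : B ⊕ C → A ⊕ (B ⊕ (C ⊕ D)))) ⊔
        γ.map (Sum.inr ∘ Sum.inr : C ⊕ D → A ⊕ (B ⊕ (C ⊕ D)))).comap
        (Sum.map id (Sum.inr ∘ Sum.inr) : A ⊕ D → A ⊕ (B ⊕ (C ⊕ D))) := by
    conv_lhs => unfold comp
    have := e1
    unfold comp at this
    rw [this, ← comap_sup_map, ← Setoid.comap_comp, map_sup, map_map, map_map, map_map]
    have f1 : (Sum.map id (Sum.map id Sum.inl) ∘ Sum.map id Sum.inl : A ⊕ B → A ⊕ (B ⊕ (C ⊕ D))) =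
        Sum.map id Sum.inl := by
      funext x; rcases x with a | a <;> rfl
    have f2 : (Sum.map id Sum.inr ∘ Sum.map id Sum.inr : A ⊕ D → A ⊕ (B ⊕ (C ⊕ D))) =
        Sum.map id (Sum.inr ∘ Sum.inr) := by
      funext x; rcases x with a | a <;> rfl
    rw [f1, f2]
    rfl
  have r : comp α (comp β γ) =
      (α.map (Sum.map id Sum.inl : A ⊕ B → A ⊕ (B ⊕ (C ⊕ D))) ⊔
        (β.map (Sum.inr ∘ Sum.map id Sum.inl : B ⊕ C → A ⊕ (B ⊕ (C ⊕ D))) ⊔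
        γ.map (Sum.inr ∘ Sum.inr : C ⊕ D → A ⊕ (B ⊕ (C ⊕ D))))).comap
        (Sum.map id (Sum.inr ∘ Sum.inr) : A ⊕ D → A ⊕ (B ⊕ (C ⊕ D))) := by
    conv_lhs => unfold comp
    have := e2
    unfold comp at this
    rw [this, sup_comm, ← comap_sup_map, ← Setoid.comap_comp, map_sup, map_map, map_map, map_map,
      sup_comm]
    have f1 : (Sum.map id (Sum.map id Sum.inr) ∘ Sum.map id Sum.inl : A ⊕ B → A ⊕ (B ⊕ (C ⊕ D))) =
        Sum.map id Sum.inl := by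
      funext x; rcases x with a | a <;> rfl
    have f2 : (Sum.map id (Sum.map id Sum.inr) ∘ Sum.map id Sum.inr : A ⊕ D → A ⊕ (B ⊕ (C ⊕ D))) =
        Sum.map id (Sum.inr ∘ Sum.inr) := by
      funext x; rcases x with a | a <;> rfl
    rw [f1, f2]
  rw [l, r, sup_assoc]

theorem id_comp {A C : Type*} (β : Setoid (A ⊕ C)) :
    comp (Setoid.ker (Sum.elim id id : A ⊕ A → A)) β = β := by
  apply le_antisymm
  · have h : (Setoid.ker (Sum.elim id id : A ⊕ A → A)).map
        (Sum.map id Sum.inl : A ⊕ A → A ⊕ (A ⊕ C)) ⊔ β.map (Sum.inr : A ⊕ C → A ⊕ (A ⊕ C)) ≤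
        β.comap (Sum.elim Sum.inl id : A ⊕ (A ⊕ C) → A ⊕ C) := by
      refine sup_le (map_le.2 ?_) (map_le.2 ?_)
      · rintro (a | a) (b | b) h <;>
          · obtain rfl : a = b := h
            exact β.refl _
      · intro x y h
        exact h
    rintro (a | a) (b | b) hab <;> exact h hab
  · set s := (Setoid.ker (Sum.elim id id : A ⊕ A → A)).map
        (Sum.map id Sum.inl : A ⊕ A → A ⊕ (A ⊕ C)) ⊔ β.map (Sum.inr : A ⊕ C → A ⊕ (A ⊕ C))
    have h1 : ∀ a : A, s (Sum.inl a) (Sum.inr (Sum.inl a)) := fun a =>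
      map_le.1 le_sup_left (show Setoid.ker (Sum.elim id id : A ⊕ A → A) (Sum.inl a) (Sum.inr a)
        from rfl)
    have h3 : ∀ x : A ⊕ C, s (Sum.map id Sum.inr x) (Sum.inr x) := by
      rintro (a | c)
      · exact h1 a
      · exact s.refl _
    intro x y hxy
    have h2 : s (Sum.inr x) (Sum.inr y) := map_le.1 le_sup_right hxy
    exact s.trans (s.trans (h3 x) h2) (s.symm (h3 y))

theorem comp_id {A B : Type*} (α : Setoid (A ⊕ B)) :
    comp α (Setoid.ker (Sum.elim id id : B ⊕ B → B)) = α := by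
  apply le_antisymm
  · have h : α.map (Sum.map id Sum.inl : A ⊕ B → A ⊕ (B ⊕ B)) ⊔
        (Setoid.ker (Sum.elim id id : B ⊕ B → B)).map (Sum.inr : B ⊕ B → A ⊕ (B ⊕ B)) ≤
        α.comap (Sum.map id (Sum.elim id id) : A ⊕ (B ⊕ B) → A ⊕ B) := by
      refine sup_le (map_le.2 ?_) (map_le.2 ?_)
      · rintro (a | a) (b | b) h <;> exact h
      · rintro (a | a) (b | b) h <;>
          · obtain rfl : a = b := h
            exact α.refl _
    rintro (a | a) (b | b) hab <;> exact h hab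
  · set s := α.map (Sum.map id Sum.inl : A ⊕ B → A ⊕ (B ⊕ B)) ⊔
        (Setoid.ker (Sum.elim id id : B ⊕ B → B)).map (Sum.inr : B ⊕ B → A ⊕ (B ⊕ B))
    have h1 : ∀ b : B, s (Sum.inr (Sum.inr b)) (Sum.inr (Sum.inl b)) := fun b =>
      map_le.1 le_sup_right (show Setoid.ker (Sum.elim id id : B ⊕ B → B) (Sum.inr b) (Sum.inl b)
        from rfl)
    have h3 : ∀ x : A ⊕ B, s (Sum.map id Sum.inr x) (Sum.map id Sum.inl x) := by
      rintro (a | b)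
      · exact s.refl _
      · exact h1 b
    intro x y hxy
    have h2 : s (Sum.map id Sum.inl x) (Sum.map id Sum.inl y) := map_le.1 le_sup_left hxy
    exact s.trans (s.trans (h3 x) h2) (s.symm (h3 y))

/-! ### The partition monoid -/

/-- The set `ℭ_n` of all set partitions of `M ∪ M'`, where `M` and `M'` are two disjoint copies
of an `n`-element set (`Sum.inl i` is `i` and `Sum.inr i` is `i'`). -/
def PartitionMonoid (n : ℕ) : Type := Setoid (Fin n ⊕ Fin n)

/-- The multiplication is the composition of diagrams; the identity has the blocks
`{i, i'}`. -/
instance (n : ℕ) : Monoid (PartitionMonoid n) where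
  mul α β := comp α β
  one := Setoid.ker (Sum.elim id id : Fin n ⊕ Fin n → Fin n)
  mul_assoc α β γ := comp_assoc α β γ
  one_mul α := id_comp α
  mul_one α := comp_id α

namespace PartitionMonoid

variable {n : ℕ}

/-- `α.Conn x y`: the pins `x` and `y` lie in the same block of `α`. -/
def Conn (α : PartitionMonoid n) (x y : Fin n ⊕ Fin n) : Prop := Setoid.r (self := α) x y

/-- The blocks of a partition. -/
def blocks (α : PartitionMonoid n) : Set (Set (Fin n ⊕ Fin n)) := Setoid.classes α

/-- A generalized line: a block that meets both `M` and `M'`. -/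
def IsGeneralizedLine (X : Set (Fin n ⊕ Fin n)) : Prop :=
  (∃ i : Fin n, Sum.inl i ∈ X) ∧ (∃ j : Fin n, Sum.inr j ∈ X)

theorem forall_blocks {α : PartitionMonoid n} {P : Set (Fin n ⊕ Fin n) → Prop} :
    (∀ X ∈ α.blocks, P X) ↔ ∀ y, P {x | α.Conn x y} := by
  constructor
  · exact fun h y => h _ ⟨y, rfl⟩
  · rintro h _ ⟨y, rfl⟩
    exact h y

theorem generalizedLine_iff {α : PartitionMonoid n} :
    (∀ X ∈ α.blocks, IsGeneralizedLine X) ↔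
      (∀ i, ∃ j, α.Conn (Sum.inl i) (Sum.inr j)) ∧ (∀ j, ∃ i, α.Conn (Sum.inl i) (Sum.inr j)) := by
  rw [forall_blocks]
  constructor
  · intro h
    refine ⟨fun i => ?_, fun j => ?_⟩
    · obtain ⟨j, hj⟩ := (h (Sum.inl i)).2
      exact ⟨j, Setoid.symm' α hj⟩
    · exact (h (Sum.inr j)).1
  · rintro ⟨h1, h2⟩ (i | j)
    · obtain ⟨j, hj⟩ := h1 i
      exact ⟨⟨i, Setoid.refl' α _⟩, ⟨j, Setoid.symm' α hj⟩⟩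
    · exact ⟨h2 j, ⟨j, Setoid.refl' α _⟩⟩

theorem conn_mul {α β : PartitionMonoid n} {i j k : Fin n}
    (h1 : α.Conn (Sum.inl i) (Sum.inr j)) (h2 : β.Conn (Sum.inl j) (Sum.inr k)) :
    (α * β).Conn (Sum.inl i) (Sum.inr k) := by
  let s := (Setoid.map α (Sum.map id Sum.inl : Fin n ⊕ Fin n → Fin n ⊕ (Fin n ⊕ Fin n)) ⊔
    Setoid.map β (Sum.inr : Fin n ⊕ Fin n → Fin n ⊕ (Fin n ⊕ Fin n)))
  have e1 : s (Sum.inl i) (Sum.inr (Sum.inl j)) := map_le.1 le_sup_left h1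
  have e2 : s (Sum.inr (Sum.inl j)) (Sum.inr (Sum.inr k)) := map_le.1 le_sup_right h2
  exact s.trans e1 e2

theorem balanced_iff {α : PartitionMonoid n} :
    (∀ X ∈ α.blocks, IsGeneralizedLine X ∧ (Sum.inl ⁻¹' X).ncard = (Sum.inr ⁻¹' X).ncard) ↔
      ∃ g : Equiv.Perm (Fin n), ∀ i, α.Conn (Sum.inl i) (Sum.inr (g i)) := by
  rw [forall_blocks]
  constructor
  · intro h
    let f1 : Fin n → Quotient α := fun i => Quotient.mk α (Sum.inl i)
    let f2 : Fin n → Quotient α := fun i => Quotient.mk α (Sum.inr i)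
    have key : ∀ c, Nonempty ({a // f1 a = c} ≃ {b // f2 b = c}) := by
      intro c
      induction c using Quotient.ind with
      | _ y =>
        have hc := (h y).2
        rw [← Nat.card_coe_set_eq, ← Nat.card_coe_set_eq] at hc
        have e1 : {a // f1 a = Quotient.mk α y} ≃
            ↥(Sum.inl ⁻¹' {x | α.Conn x y} : Set (Fin n)) :=
          Equiv.subtypeEquivRight fun a => Quotient.eq
        have e2 : {a // f2 a = Quotient.mk α y} ≃
            ↥(Sum.inr ⁻¹' {x | α.Conn x y} : Set (Fin n)) :=
          Equiv.subtypeEquivRight fun a => Quotient.eq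
        exact ⟨(e1.trans ((Finite.card_eq.1 hc).some)).trans e2.symm⟩
    refine ⟨Equiv.ofFiberEquiv (fun c => (key c).some), fun i => ?_⟩
    have := Equiv.ofFiberEquiv_map (f := f1) (g := f2) (fun c => (key c).some) i
    exact Setoid.symm' α (Quotient.exact this)
  · rintro ⟨g, hg⟩ y
    refine ⟨?_, ?_⟩
    · refine (forall_blocks.1 (generalizedLine_iff.2 ⟨fun i => ⟨g i, hg i⟩, fun j => ?_⟩) y)
      exact ⟨g.symm j, by simpa using hg (g.symm j)⟩
    · have : (Sum.inr ⁻¹' {x | α.Conn x y} : Set (Fin n)) =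
          g '' (Sum.inl ⁻¹' {x | α.Conn x y}) := by
        ext j
        constructor
        · intro hj
          refine ⟨g.symm j, ?_, by simp⟩
          have h1 : α.Conn (Sum.inl (g.symm j)) (Sum.inr j) := by simpa using hg (g.symm j)
          exact Setoid.trans' α h1 hj
        · rintro ⟨i, hi, rfl⟩
          exact Setoid.trans' α (Setoid.symm' α (hg i)) hi
      rw [this, Set.ncard_image_of_injective _ g.injective]

end PartitionMonoid

open PartitionMonoid in
/-- The submonoid `𝓘𝓟_n` of `ℭ_n` of all partitions whose blocks are generalized lines. -/
def IP (n : ℕ) : Submonoid (PartitionMonoid n) where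
  carrier := {α | ∀ X ∈ α.blocks, IsGeneralizedLine X}
  one_mem' := generalizedLine_iff.2 ⟨fun i => ⟨i, rfl⟩, fun i => ⟨i, rfl⟩⟩
  mul_mem' := by
    intro α β hα hβ
    obtain ⟨a1, a2⟩ := generalizedLine_iff.1 hα
    obtain ⟨b1, b2⟩ := generalizedLine_iff.1 hβ
    refine generalizedLine_iff.2 ⟨fun i => ?_, fun k => ?_⟩
    · obtain ⟨j, hj⟩ := a1 i
      obtain ⟨k, hk⟩ := b1 j
      exact ⟨k, conn_mul hj hk⟩
    · obtain ⟨j, hj⟩ := b2 k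
      obtain ⟨i, hi⟩ := a2 j
      exact ⟨i, conn_mul hi hj⟩

open PartitionMonoid in
/-- The submonoid `𝓘𝓣_n` of `ℭ_n` of all partitions each of whose blocks `X` is a generalized
line with `|X ∩ M| = |X ∩ M'|`. -/
def IT (n : ℕ) : Submonoid (PartitionMonoid n) where
  carrier := {α | ∀ X ∈ α.blocks,
    IsGeneralizedLine X ∧ (Sum.inl ⁻¹' X).ncard = (Sum.inr ⁻¹' X).ncard}
  one_mem' := balanced_iff.2 ⟨1, fun _ => rfl⟩
  mul_mem' := by
    intro α β hα hβ
    obtain ⟨g, hg⟩ := balanced_iff.1 hα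
    obtain ⟨h, hh⟩ := balanced_iff.1 hβ
    exact balanced_iff.2 ⟨g.trans h, fun i => conn_mul (hg i) (hh (g i))⟩

/-! ### The generators of `𝓘𝓣_n`

The index `i : Fin (n - 1)` stands for the number `i + 1` in `{1, …, n - 1}`; the points
`lo i` and `hi i` of `Fin n` stand for the numbers `i + 1` and `i + 2`. -/

/-- The lower of the two neighbouring points with index `i`. -/
def lo {n : ℕ} (i : Fin (n - 1)) : Fin n := ⟨i.1, by omega⟩

/-- The upper of the two neighbouring points with index `i`. -/
def hi {n : ℕ} (i : Fin (n - 1)) : Fin n := ⟨i.1 + 1, by omega⟩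

/-- The element `s_i`: the blocks are `{j, g(j)'}`, where `g` is the transposition of the two
points `lo i` and `hi i`. -/
def s {n : ℕ} (i : Fin (n - 1)) : IT n :=
  ⟨(Setoid.ker (Sum.elim (Equiv.swap (lo i) (hi i)) id : Fin n ⊕ Fin n → Fin n) :
      Setoid (Fin n ⊕ Fin n)),
    PartitionMonoid.balanced_iff.2 ⟨Equiv.swap (lo i) (hi i), fun _ => rfl⟩⟩

/-- The map that sends `hi i` to `lo i` and fixes all other points. -/
def collapse {n : ℕ} (i : Fin (n - 1)) (x : Fin n) : Fin n := if x = hi i then lo i else x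

/-- The element `ϱ_i`: the blocks are `{lo i, hi i, (lo i)', (hi i)'}` and `{j, j'}` for all other
points `j`. -/
def rho {n : ℕ} (i : Fin (n - 1)) : IT n :=
  ⟨(Setoid.ker (Sum.elim (collapse i) (collapse i) : Fin n ⊕ Fin n → Fin n) :
      Setoid (Fin n ⊕ Fin n)),
    PartitionMonoid.balanced_iff.2 ⟨1, fun _ => rfl⟩⟩

/-! ### The presented monoid `T` -/

/-- The generators `σ_i`, `τ_i`, one of each for every index `i`. -/
inductive Gen (n : ℕ) : Type
  | sig (i : Fin (n - 1)) : Gen n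
  | tau (i : Fin (n - 1)) : Gen n

/-- The letter `σ_i` of the free monoid. -/
def σ {n : ℕ} (i : Fin (n - 1)) : FreeMonoid (Gen n) := FreeMonoid.of (Gen.sig i)

/-- The letter `τ_i` of the free monoid. -/
def τ {n : ℕ} (i : Fin (n - 1)) : FreeMonoid (Gen n) := FreeMonoid.of (Gen.tau i)

/-- `|i - j| = 1`. -/
def Near {n : ℕ} (i j : Fin (n - 1)) : Prop := i.1 + 1 = j.1 ∨ j.1 + 1 = i.1

/-- `|i - j| > 1`. -/
def Far {n : ℕ} (i j : Fin (n - 1)) : Prop := i.1 + 1 < j.1 ∨ j.1 + 1 < i.1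

/-- The defining relations of `T`. -/
inductive Rel (n : ℕ) : FreeMonoid (Gen n) → FreeMonoid (Gen n) → Prop
  | sig_sq (i : Fin (n - 1)) : Rel n (σ i * σ i) 1
  | sig_comm (i j : Fin (n - 1)) : Far i j → Rel n (σ i * σ j) (σ j * σ i)
  | braid (i j : Fin (n - 1)) : Near i j → Rel n (σ i * σ j * σ i) (σ j * σ i * σ j)
  | tau_idem (i : Fin (n - 1)) : Rel n (τ i * τ i) (τ i)
  | tau_comm (i j : Fin (n - 1)) : i ≠ j → Rel n (τ i * τ j) (τ j * τ i)
  | tau_sig (i : Fin (n - 1)) : Rel n (τ i * σ i) (τ i)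
  | sig_tau (i : Fin (n - 1)) : Rel n (σ i * τ i) (τ i)
  | tau_sig_comm (i j : Fin (n - 1)) : Far i j → Rel n (τ i * σ j) (σ j * τ i)
  | sig_tau_sig (i j : Fin (n - 1)) : Near i j → Rel n (σ i * τ j * σ i) (σ j * τ i * σ j)
  | tau_sig_tau (i j : Fin (n - 1)) : Near i j → Rel n (τ i * σ j * τ i) (τ i * τ j)

/-- The monoid `T` generated by the `σ_i` and `τ_i` subject to the defining relations. -/
abbrev T (n : ℕ) : Type := PresentedMonoid (Rel n)

/-! ### The dual symmetric inverse monoid -/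

/-- A binary relation is difunctional if `R ∘ R⁻¹ ∘ R ⊆ R`. -/
def Difunctional {X : Type*} (R : X → X → Prop) : Prop :=
  ∀ a b c d, R a b → R c b → R c d → R a d

/-- The smallest difunctional relation that contains `R`. -/
def difClosure {X : Type*} (R : X → X → Prop) : X → X → Prop :=
  fun a b => ∀ D : X → X → Prop, Difunctional D → (∀ x y, R x y → D x y) → D a b

theorem difClosure_dif {X : Type*} (R : X → X → Prop) : Difunctional (difClosure R) :=
  fun a b c d h1 h2 h3 D hD hR => hD a b c d (h1 D hD hR) (h2 D hD hR) (h3 D hD hR)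

theorem le_difClosure {X : Type*} {R : X → X → Prop} {a b : X} (h : R a b) : difClosure R a b :=
  fun _ _ hR => hR a b h

/-- The elements of the dual symmetric inverse monoid on `X`: the full difunctional binary
relations on `X` (also called biequivalences); full means that the domain and the range are `X`. -/
@[ext]
structure DualSymInv (X : Type*) where
  /-- the underlying relation -/
  rel : X → X → Prop
  dom_full : ∀ a, ∃ b, rel a b
  ran_full : ∀ b, ∃ a, rel a b
  difunctional : Difunctional rel

namespace DualSymInv

variable {X : Type*}

/-- The product is the smallest difunctional relation that contains the composite of the two
relations. -/
instance : Mul (DualSymInv X) where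
  mul R S :=
    { rel := difClosure (Relation.Comp R.rel S.rel)
      dom_full := fun a => by
        obtain ⟨b, hb⟩ := R.dom_full a
        obtain ⟨c, hc⟩ := S.dom_full b
        exact ⟨c, le_difClosure ⟨b, hb, hc⟩⟩
      ran_full := fun c => by
        obtain ⟨b, hb⟩ := S.ran_full c
        obtain ⟨a, ha⟩ := R.ran_full b
        exact ⟨a, le_difClosure ⟨b, ha, hb⟩⟩
      difunctional := difClosure_dif _ }

/-- The identity relation. -/
instance : One (DualSymInv X) where
  one :=
    { rel := Eq
      dom_full := fun a => ⟨a, rfl⟩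
      ran_full := fun a => ⟨a, rfl⟩
      difunctional := by
        rintro a b c d rfl rfl rfl
        rfl }

theorem mul_rel (R S : DualSymInv X) : (R * S).rel = difClosure (Relation.Comp R.rel S.rel) := rfl

theorem one_rel : (1 : DualSymInv X).rel = Eq := rfl

theorem difClosure_eq (R : DualSymInv X) : difClosure R.rel = R.rel := by
  funext a b
  exact propext ⟨fun h => h _ R.difunctional fun _ _ => id, le_difClosure⟩

theorem mul_assoc_left (R S U : DualSymInv X) :
    (R * S * U).rel = difClosure (Relation.Comp (Relation.Comp R.rel S.rel) U.rel) := by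
  funext a b
  refine propext ⟨fun h D hD hR => ?_, fun h D hD hR => ?_⟩
  · refine h D hD ?_
    rintro x z ⟨y, hxy, hyz⟩
    refine hxy (fun x y => ∀ z, U.rel y z → D x z) ?_ ?_ z hyz
    · intro p q r t h1 h2 h3 z hz
      obtain ⟨w, hw⟩ := U.dom_full q
      exact hD _ _ _ _ (h1 w hw) (h2 w hw) (h3 z hz)
    · intro p q hpq z hz
      exact hR _ _ ⟨q, hpq, hz⟩
  · refine h D hD ?_
    rintro x z ⟨y, hxy, hyz⟩
    exact hR _ _ ⟨y, le_difClosure hxy, hyz⟩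

theorem mul_assoc_right (R S U : DualSymInv X) :
    (R * (S * U)).rel = difClosure (Relation.Comp R.rel (Relation.Comp S.rel U.rel)) := by
  funext a b
  refine propext ⟨fun h D hD hR => ?_, fun h D hD hR => ?_⟩
  · refine h D hD ?_
    rintro x z ⟨y, hxy, hyz⟩
    refine hyz (fun y z => ∀ x, R.rel x y → D x z) ?_ ?_ x hxy
    · intro p q r t h1 h2 h3 x hx
      obtain ⟨w, hw⟩ := R.ran_full r
      exact hD _ _ _ _ (h1 x hx) (h2 w hw) (h3 w hw)
    · intro p q hpq x hx
      exact hR _ _ ⟨p, hx, hpq⟩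
  · refine h D hD ?_
    rintro x z ⟨y, hxy, hyz⟩
    exact hR _ _ ⟨y, hxy, le_difClosure hyz⟩

instance : Monoid (DualSymInv X) where
  mul_assoc R S U := by
    ext1
    rw [mul_assoc_left, mul_assoc_right, Relation.comp_assoc]
  one_mul R := by
    ext1
    rw [mul_rel, one_rel, Relation.eq_comp, difClosure_eq]
  mul_one R := by
    ext1
    rw [mul_rel, one_rel, Relation.comp_eq, difClosure_eq]

end DualSymInv

/-! ### Inverse and factorizable monoids -/

/-- A monoid is inverse if every element `x` has exactly one inverse in the sense of semigroup
theory, that is, exactly one `y` with `x y x = x` and `y x y = y`. -/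
def IsInverseMonoid (S : Type*) [Monoid S] : Prop :=
  ∀ x : S, ∃! y : S, x * y * x = x ∧ y * x * y = y

/-- A monoid is factorizable if every element is the product of an idempotent and a unit. -/
def IsFactorizable (S : Type*) [Monoid S] : Prop :=
  ∀ x : S, ∃ e : S, ∃ u : Sˣ, IsIdempotentElem e ∧ x = e * u

/-- The factorizable inverse submonoids of a monoid `S`. -/
def factorizableInverseSubmonoids (S : Type*) [Monoid S] : Set (Submonoid S) :=
  {H | IsInverseMonoid H ∧ IsFactorizable H}

end BrauerType

namespace BrauerType

/-! ### Idempotents, units and inverses in the dual symmetric inverse monoid. -/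

namespace DualSymInv

variable {X : Type*}

/-! The whole argument takes place in `DualSymInv`. Its idempotents are the equivalence relations
(`exists_ofSetoid_of_idem`), its units are the permutations (`exists_ofPerm_of_unit`), and `ofSetoid
r * ofPerm p` is simply the relation `r a (p c)`. A difunctional relation is such a product exactly
when it contains the graph of a permutation. On the side of partitions this says that every block
has as many points in `M` as in `M'`. So the image of `IT n` consists of all products of an
idempotent and a unit, and any factorizable submonoid lies inside it. Since idempotents commute,
inverses are unique.

For the presentation, `T n` is mapped to `DualSymInv` and the kernel has to be shown trivial. The
Coxeter relations make the `σ_i` generate a copy of the symmetric group (`toDual_injOn`, `permT`).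
The conjugates of the `τ_i` under this group depend only on an unordered pair of points
(`permT_mul_pairTau`), which yields elements `pairTau a b`. They are commuting idempotents, and they
satisfy `pairTau_trans`, the algebraic form of transitivity. Therefore a product of them depends
only on the equivalence relation that its pairs generate (`listTau_eq`), and it absorbs every
permutation that preserves each class (`listTau_mul_permT`). Each element of `T n` is such a product
times a permutation. By `ofSetoid_mul_ofPerm_eq` these are just the coincidences that occur among
the images, so the map is injective; it reaches everything because each equivalence relation on a
finite set is generated by finitely many pairs. -/

theorem le_mul_rel {R S : DualSymInv X} {a b c : X} (h1 : R.rel a b) (h2 : S.rel b c) :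
    (R * S).rel a c :=
  le_difClosure ⟨b, h1, h2⟩

theorem mul_rel_le {R S : DualSymInv X} {D : X → X → Prop} (hD : Difunctional D)
    (h : ∀ a b c, R.rel a b → S.rel b c → D a c) {a c : X} (hac : (R * S).rel a c) : D a c :=
  hac D hD fun a c ⟨b, h1, h2⟩ => h a b c h1 h2

/-- The graph of the inverse of a permutation. -/
def ofPerm : Equiv.Perm X →* DualSymInv X where
  toFun p :=
    { rel := fun a b => a = p b
      dom_full := fun a => ⟨p.symm a, by simp⟩
      ran_full := fun b => ⟨p b, rfl⟩
      difunctional := by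
        intro a b c d h1 h2 h3
        rw [h1, ← h2, h3] }
  map_one' := rfl
  map_mul' p q := by
    refine DualSymInv.ext (funext₂ fun a c => propext ⟨?_, fun h => ?_⟩)
    · rintro rfl
      exact le_mul_rel (b := q c) rfl rfl
    · refine mul_rel_le (D := fun a c => a = p (q c)) ?_ ?_ h
      · intro a b c d h1 h2 h3
        rw [h1, ← h2, h3]
      · rintro a b c rfl rfl
        rfl

theorem ofPerm_rel {p : Equiv.Perm X} {a b : X} : (ofPerm p).rel a b ↔ a = p b := Iff.rfl

theorem ofPerm_injective : Function.Injective (ofPerm : Equiv.Perm X → DualSymInv X) := by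
  intro p q h
  ext b
  have : (ofPerm q).rel (p b) b := h ▸ ofPerm_rel.2 rfl
  exact this

theorem setoid_difunctional (r : Setoid X) : Difunctional r :=
  fun _ _ _ _ h1 h2 h3 => r.trans h1 (r.trans (r.symm h2) h3)

/-- An equivalence relation as an element of the dual symmetric inverse monoid. -/
def ofSetoid (r : Setoid X) : DualSymInv X where
  rel := r
  dom_full a := ⟨a, r.refl a⟩
  ran_full a := ⟨a, r.refl a⟩
  difunctional := setoid_difunctional r

/-- A reflexive difunctional relation is symmetric and transitive. So the difunctional closure of
the composite is an equivalence relation, and it contains both factors. -/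
theorem ofSetoid_mul (r t : Setoid X) : ofSetoid r * ofSetoid t = ofSetoid (r ⊔ t) := by
  refine DualSymInv.ext (funext₂ fun a c => propext ⟨fun h => ?_, fun h => ?_⟩)
  · refine mul_rel_le (setoid_difunctional (r ⊔ t)) (fun a b c h1 h2 => ?_) h
    exact (r ⊔ t).trans ((le_sup_left : r ≤ r ⊔ t) h1) ((le_sup_right : t ≤ r ⊔ t) h2)
  · have hd := (ofSetoid r * ofSetoid t).difunctional
    have hr : ∀ a, (ofSetoid r * ofSetoid t).rel a a := fun a =>
      le_mul_rel (r.refl a) (t.refl a)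
    let q : Setoid X :=
      { r := (ofSetoid r * ofSetoid t).rel
        iseqv :=
          { refl := hr
            symm := fun {a b} h => hd _ _ _ _ (hr b) h (hr a)
            trans := fun {a b c} h1 h2 => hd _ _ _ _ h1 (hr b) h2 } }
    have : r ⊔ t ≤ q :=
      sup_le (fun {_ b} h => le_mul_rel h (t.refl b)) (fun {a _} h => le_mul_rel (r.refl a) h)
    exact this h

theorem ofSetoid_bot : ofSetoid (⊥ : Setoid X) = 1 := rfl

/-- The composite is difunctional already, so the closure adds nothing. -/
theorem ofSetoid_mul_ofPerm_rel {r : Setoid X} {p : Equiv.Perm X} {a c : X} :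
    (ofSetoid r * ofPerm p).rel a c ↔ r a (p c) := by
  refine ⟨fun h => ?_, fun h => le_mul_rel (b := p c) h rfl⟩
  refine mul_rel_le (D := fun a c => r a (p c)) ?_ ?_ h
  · exact fun _ _ _ _ h1 h2 h3 => r.trans h1 (r.trans (r.symm h2) h3)
  · rintro a b c h rfl
    exact h

theorem ofPerm_mul_ofSetoid (r : Setoid X) (p : Equiv.Perm X) :
    ofPerm p * ofSetoid r = ofSetoid (r.comap p.symm) * ofPerm p := by
  refine DualSymInv.ext (funext₂ fun a c => propext ?_)
  rw [ofSetoid_mul_ofPerm_rel, Setoid.comap_rel, Equiv.symm_apply_apply]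
  refine ⟨fun h => ?_, fun h => le_mul_rel (b := p.symm a) (by simp [ofPerm_rel]) h⟩
  refine mul_rel_le (D := fun a c => r (p.symm a) c) ?_ ?_ h
  · exact fun _ _ _ _ h1 h2 h3 => r.trans h1 (r.trans (r.symm h2) h3)
  · rintro a b c rfl h
    rwa [Equiv.symm_apply_apply]

/-- The equivalence relation is determined by the product, the permutation only up to moves inside
the classes. Evaluating both sides at the pair `(q a, a)` shows that `p a` and `q a` are related. -/
theorem ofSetoid_mul_ofPerm_eq {r t : Setoid X} {p q : Equiv.Perm X} :
    ofSetoid r * ofPerm p = ofSetoid t * ofPerm q ↔ r = t ∧ ∀ a, r (p a) (q a) := by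
  constructor
  · intro h
    have h' : ∀ a c, r a (p c) ↔ t a (q c) := fun a c => by
      rw [← ofSetoid_mul_ofPerm_rel, h, ofSetoid_mul_ofPerm_rel]
    have h1 : ∀ a, r (p a) (q a) := fun a => r.symm ((h' _ _).2 (t.refl _))
    refine ⟨Setoid.ext fun a b => ?_, h1⟩
    obtain ⟨c, rfl⟩ := q.surjective b
    rw [← h' a c]
    exact ⟨fun h => r.trans h (r.symm (h1 c)), fun h => r.trans h (h1 c)⟩
  · rintro ⟨rfl, h⟩
    refine DualSymInv.ext (funext₂ fun a c => propext ?_)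
    rw [ofSetoid_mul_ofPerm_rel, ofSetoid_mul_ofPerm_rel]
    exact ⟨fun k => r.trans k (h c), fun k => r.trans k (r.symm (h c))⟩

theorem ofSetoid_mul_ofPerm_eq_self {r : Setoid X} {p : Equiv.Perm X} (h : ∀ a, r a (p a)) :
    ofSetoid r * ofPerm p = ofSetoid r := by
  have := (ofSetoid_mul_ofPerm_eq (r := r) (t := r) (p := p) (q := 1)).2
    ⟨rfl, fun a => r.symm (h a)⟩
  rwa [map_one, mul_one] at this

/-- An idempotent is an equivalence relation. -/
theorem exists_ofSetoid_of_idem {e : DualSymInv X} (he : IsIdempotentElem e) :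
    ∃ r : Setoid X, e = ofSetoid r := by
  have ht : ∀ {a b c}, e.rel a b → e.rel b c → e.rel a c := fun h1 h2 =>
    he ▸ le_mul_rel h1 h2
  -- With `a – b` and `b – c`, transitivity gives `a – c`, and the zigzag `b – c`, `a – c`, `a – b`
  -- closes to `b – b`.
  have hr : ∀ b, e.rel b b := fun b => by
    obtain ⟨a, hab⟩ := e.ran_full b
    obtain ⟨c, hbc⟩ := e.dom_full b
    exact e.difunctional b c a b hbc (ht hab hbc) hab
  exact ⟨{ r := e.rel
           iseqv := ⟨hr, fun {a b} h => e.difunctional _ _ _ _ (hr b) h (hr a), ht⟩ }, rfl⟩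

theorem ofSetoid_idem (r : Setoid X) : IsIdempotentElem (ofSetoid r) := by
  rw [IsIdempotentElem, ofSetoid_mul, sup_idem]

/-- A unit is the graph of a permutation. -/
theorem exists_ofPerm_of_unit (u : (DualSymInv X)ˣ) :
    ∃ p : Equiv.Perm X, (u : DualSymInv X) = ofPerm p := by
  -- The composite lies in the product, and the product of `u` and its inverse is equality. This
  -- makes `u` and its inverse single-valued.
  have h1 : ∀ {a b c}, u.1.rel a b → (u⁻¹).1.rel b c → a = c := fun {a b c} h k => by
    have := le_mul_rel h k
    rwa [Units.mul_inv] at this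
  have h2 : ∀ {a b c}, (u⁻¹).1.rel a b → u.1.rel b c → a = c := fun {a b c} h k => by
    have := le_mul_rel h k
    rwa [Units.inv_mul] at this
  choose f hf using u.1.ran_full
  choose g hg using (u⁻¹).1.ran_full
  have hfu : ∀ a b, u.1.rel a b ↔ a = f b := fun a b => by
    refine ⟨fun h => ?_, fun h => h ▸ hf b⟩
    obtain ⟨c, hc⟩ := (u⁻¹).1.dom_full b
    exact (h1 h hc).trans (h1 (hf b) hc).symm
  refine ⟨⟨f, g, fun b => h2 (hg (f b)) (hf b), fun a => h1 (hf (g a)) (hg a)⟩, ?_⟩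
  exact DualSymInv.ext (funext₂ fun a b => propext (hfu a b))

/-- The inverse relation. -/
def inv (R : DualSymInv X) : DualSymInv X where
  rel a b := R.rel b a
  dom_full := R.ran_full
  ran_full := R.dom_full
  difunctional a b c d h1 h2 h3 := R.difunctional d c b a h3 h2 h1

/-- The plain triple composite lies in `R` by difunctionality, and by `mul_assoc_left` a single
closure at the end suffices. -/
theorem mul_inv_mul (R : DualSymInv X) : R * R.inv * R = R := by
  refine DualSymInv.ext (funext₂ fun a d => propext ⟨fun h => ?_, fun h => ?_⟩)
  · rw [mul_assoc_left] at h
    refine h _ R.difunctional ?_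
    rintro a d ⟨c, ⟨b, h1, h2⟩, h3⟩
    exact R.difunctional _ _ _ _ h1 h2 h3
  · exact le_mul_rel (le_mul_rel h (show R.inv.rel d a from h)) h

theorem idem_comm {e f : DualSymInv X} (he : IsIdempotentElem e) (hf : IsIdempotentElem f) :
    e * f = f * e := by
  obtain ⟨r, rfl⟩ := exists_ofSetoid_of_idem he
  obtain ⟨t, rfl⟩ := exists_ofSetoid_of_idem hf
  rw [ofSetoid_mul, ofSetoid_mul, sup_comm]

/-- The usual argument for semigroups with commuting idempotents, applied to `x * y`, `x * z`, `y *
x` and `z * x`. -/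
theorem inverse_unique {x y z : DualSymInv X} (hy : x * y * x = x) (hy' : y * x * y = y)
    (hz : x * z * x = x) (hz' : z * x * z = z) : y = z := by
  have i1 : IsIdempotentElem (x * y) := by rw [IsIdempotentElem, ← mul_assoc, hy]
  have i2 : IsIdempotentElem (x * z) := by rw [IsIdempotentElem, ← mul_assoc, hz]
  have i3 : IsIdempotentElem (y * x) := by rw [IsIdempotentElem, ← mul_assoc, hy']
  have i4 : IsIdempotentElem (z * x) := by rw [IsIdempotentElem, ← mul_assoc, hz']
  calc y = y * (x * z * x) * y := by rw [hz, hy']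
    _ = y * ((x * z) * (x * y)) := by simp only [mul_assoc]
    _ = y * ((x * y) * (x * z)) := by rw [idem_comm i2 i1]
    _ = (y * x * y) * x * z := by simp only [mul_assoc]
    _ = y * x * z := by rw [hy']
    _ = y * x * (z * x * z) := by rw [hz']
    _ = (y * x) * (z * x) * z := by simp only [mul_assoc]
    _ = (z * x) * (y * x) * z := by rw [idem_comm i3 i4]
    _ = z * (x * y * x) * z := by simp only [mul_assoc]
    _ = z := by rw [hy, hz']

/-- The relations that contain the graph of a permutation. -/
def balanced (X : Type*) : Submonoid (DualSymInv X) where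
  carrier := {R | ∃ g : Equiv.Perm X, ∀ i, R.rel i (g i)}
  one_mem' := ⟨1, fun _ => rfl⟩
  mul_mem' := by
    rintro R S ⟨g, hg⟩ ⟨h, hh⟩
    exact ⟨g.trans h, fun i => le_mul_rel (hg i) (hh (g i))⟩

theorem ofSetoid_mem_balanced (r : Setoid X) : ofSetoid r ∈ balanced X := ⟨1, r.refl⟩

theorem ofPerm_mem_balanced (p : Equiv.Perm X) : ofPerm p ∈ balanced X :=
  ⟨p.symm, fun i => by simp [ofPerm_rel]⟩

/-- Shifting `R` along `g` makes it reflexive, hence by difunctionality an equivalence relation; the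
factor `ofPerm g.symm` undoes the shift. -/
theorem exists_of_mem_balanced {R : DualSymInv X} (h : R ∈ balanced X) :
    ∃ (r : Setoid X) (p : Equiv.Perm X), R = ofSetoid r * ofPerm p := by
  obtain ⟨g, hg⟩ := h
  have hd := R.difunctional
  refine ⟨{ r := fun a b => R.rel a (g b)
            iseqv := ⟨hg, fun {a b} h => hd _ _ _ _ (hg b) h (hg a),
              fun {a b c} h1 h2 => hd _ _ _ _ h1 (hg b) h2⟩ }, g.symm, ?_⟩
  refine DualSymInv.ext (funext₂ fun a c => propext ?_)
  rw [ofSetoid_mul_ofPerm_rel]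
  change _ ↔ R.rel a (g (g.symm c))
  rw [Equiv.apply_symm_apply]

theorem inv_mem_balanced {R : DualSymInv X} (h : R ∈ balanced X) : R.inv ∈ balanced X := by
  obtain ⟨g, hg⟩ := h
  refine ⟨g.symm, fun i => ?_⟩
  have := hg (g.symm i)
  rwa [Equiv.apply_symm_apply] at this

/-- The relations that contain the graph of a permutation form the greatest factorizable inverse
submonoid. -/
theorem isGreatest_balanced :
    IsGreatest (factorizableInverseSubmonoids (DualSymInv X)) (balanced X) := by
  refine ⟨⟨fun x => ?_, fun x => ?_⟩, ?_⟩
  · refine ⟨⟨x.1.inv, inv_mem_balanced x.2⟩,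
      ⟨Subtype.ext (mul_inv_mul x.1), Subtype.ext (mul_inv_mul x.1.inv)⟩, fun y hy => ?_⟩
    exact Subtype.ext (inverse_unique (congrArg Subtype.val hy.1) (congrArg Subtype.val hy.2)
      (mul_inv_mul x.1) (mul_inv_mul x.1.inv))
  · obtain ⟨r, p, h⟩ := exists_of_mem_balanced x.2
    refine ⟨⟨_, ofSetoid_mem_balanced r⟩,
      ⟨⟨_, ofPerm_mem_balanced p⟩, ⟨_, ofPerm_mem_balanced p⁻¹⟩, ?_, ?_⟩, ?_, Subtype.ext h⟩
    · exact Subtype.ext (by rw [Submonoid.coe_mul, ← map_mul, mul_inv_cancel, map_one]; rfl)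
    · exact Subtype.ext (by rw [Submonoid.coe_mul, ← map_mul, inv_mul_cancel, map_one]; rfl)
    · exact Subtype.ext (ofSetoid_idem r)
  -- Idempotents and units of `H` remain idempotents and units in the whole monoid, so they are
  -- equivalence relations and permutations, all of which are balanced.
  · rintro H ⟨-, hH⟩ x hx
    obtain ⟨e, u, he, hxe⟩ := hH ⟨x, hx⟩
    obtain ⟨r, hr⟩ := exists_ofSetoid_of_idem (e := e.1) (congrArg Subtype.val he)
    obtain ⟨p, hp⟩ := exists_ofPerm_of_unit (Units.map H.subtype u)
    have : x = ofSetoid r * ofPerm p := by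
      rw [← hr, ← hp]
      exact congrArg Subtype.val hxe
    rw [this]
    exact mul_mem (ofSetoid_mem_balanced r) (ofPerm_mem_balanced p)

end DualSymInv

/-! ### Partitions into generalized lines as difunctional relations -/

namespace PartitionMonoid

variable {n : ℕ}

theorem conn_symm {α : PartitionMonoid n} {x y : Fin n ⊕ Fin n} (h : α.Conn x y) : α.Conn y x :=
  Setoid.symm' α h

theorem conn_trans {α : PartitionMonoid n} {x y z : Fin n ⊕ Fin n} (h : α.Conn x y)
    (k : α.Conn y z) : α.Conn x z :=
  Setoid.trans' α h k

/-- The relation on `M` given by the generalized lines of a partition. -/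
def toDualSymInv (α : IP n) : DualSymInv (Fin n) where
  rel i j := α.1.Conn (Sum.inl i) (Sum.inr j)
  dom_full := (generalizedLine_iff.1 α.2).1
  ran_full := (generalizedLine_iff.1 α.2).2
  difunctional _ _ _ _ h1 h2 h3 := conn_trans h1 (conn_trans (conn_symm h2) h3)

/-- The partition whose blocks are the generalized lines of a difunctional relation. -/
def ofDualSymInv (R : DualSymInv (Fin n)) : PartitionMonoid n :=
  Setoid.ker (Sum.elim (fun i => {j | R.rel i j}) (fun j => {j' | ∃ i, R.rel i j ∧ R.rel i j'}))

theorem ofDualSymInv_conn {R : DualSymInv (Fin n)} {i j : Fin n} :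
    (ofDualSymInv R).Conn (Sum.inl i) (Sum.inr j) ↔ R.rel i j := by
  change {j | R.rel i j} = {j' | ∃ i, R.rel i j ∧ R.rel i j'} ↔ _
  constructor
  · intro h
    obtain ⟨i', hi'⟩ := R.ran_full j
    exact (Set.ext_iff.1 h j).2 ⟨i', hi', hi'⟩
  · intro h
    ext k
    exact ⟨fun hk => ⟨i, h, hk⟩, fun ⟨i', h1, h2⟩ => R.difunctional _ _ _ _ h h1 h2⟩

theorem ofDualSymInv_mem (R : DualSymInv (Fin n)) : ofDualSymInv R ∈ IP n := by
  refine generalizedLine_iff.2 ⟨fun i => ?_, fun j => ?_⟩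
  · simpa only [ofDualSymInv_conn] using R.dom_full i
  · simpa only [ofDualSymInv_conn] using R.ran_full j

/-- Since every block of `α` meets both layers, a connection inside one layer splits into two
connections across. -/
theorem le_of_forall_conn {α β : PartitionMonoid n} (hα : α ∈ IP n)
    (h : ∀ i j, α.Conn (Sum.inl i) (Sum.inr j) → β.Conn (Sum.inl i) (Sum.inr j))
    {x y : Fin n ⊕ Fin n} (hxy : α.Conn x y) : β.Conn x y := by
  obtain ⟨a1, a2⟩ := generalizedLine_iff.1 hα
  rcases x with i | i <;> rcases y with j | j
  · obtain ⟨k, hk⟩ := a1 j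
    exact conn_trans (h _ _ (conn_trans hxy hk)) (conn_symm (h _ _ hk))
  · exact h _ _ hxy
  · exact conn_symm (h _ _ (conn_symm hxy))
  · obtain ⟨k, hk⟩ := a2 i
    exact conn_trans (conn_symm (h _ _ hk)) (h _ _ (conn_trans hk hxy))

theorem ext_of_forall_conn {α β : PartitionMonoid n} (hα : α ∈ IP n) (hβ : β ∈ IP n)
    (h : ∀ i j, α.Conn (Sum.inl i) (Sum.inr j) ↔ β.Conn (Sum.inl i) (Sum.inr j)) : α = β :=
  Setoid.ext fun _ _ => ⟨le_of_forall_conn hα fun i j => (h i j).1,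
    le_of_forall_conn hβ fun i j => (h i j).2⟩

theorem toDualSymInv_injective : Function.Injective (toDualSymInv : IP n → DualSymInv (Fin n)) := by
  intro α β h
  refine Subtype.ext (ext_of_forall_conn α.2 β.2 fun i j => ?_)
  have := congrArg (fun R => R.rel i j) h
  exact iff_of_eq this

theorem toDualSymInv_mul (α β : IP n) :
    toDualSymInv (α * β) = toDualSymInv α * toDualSymInv β := by
  refine DualSymInv.ext (funext₂ fun i k => propext ⟨fun h => ?_, fun h => ?_⟩)
  · set D := toDualSymInv α * toDualSymInv β
    choose f hf using (generalizedLine_iff.1 β.2).1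
    let γ : PartitionMonoid n := ofDualSymInv D
    have hγ : ∀ {i j k}, α.1.Conn (Sum.inl i) (Sum.inr j) → β.1.Conn (Sum.inl j) (Sum.inr k) →
        γ.Conn (Sum.inl i) (Sum.inr k) := fun {i j k} h1 h2 =>
      ofDualSymInv_conn.2 (DualSymInv.le_mul_rel (R := toDualSymInv α) (S := toDualSymInv β) h1 h2)
    -- A retraction of the three layers onto the outer two: the middle point `j` goes to a right
    -- point `f j` to which `β` joins it. The pullback of `γ` along `F` contains the connections of
    -- `α` and `β`, hence all that they generate.
    let F : Fin n ⊕ (Fin n ⊕ Fin n) → Fin n ⊕ Fin n :=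
      Sum.elim Sum.inl (Sum.elim (fun j => Sum.inr (f j)) Sum.inr)
    have key : Setoid.map α.1 (Sum.map id Sum.inl : Fin n ⊕ Fin n → Fin n ⊕ (Fin n ⊕ Fin n)) ⊔
        Setoid.map β.1 (Sum.inr : Fin n ⊕ Fin n → Fin n ⊕ (Fin n ⊕ Fin n)) ≤
          Setoid.comap F γ := by
      refine sup_le (map_le.2 ?_) (map_le.2 ?_)
      · intro x y h
        refine le_of_forall_conn (β := Setoid.comap (F ∘ Sum.map id Sum.inl) γ) α.2 ?_ h
        exact fun i j hij => hγ hij (hf j)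
      · intro x y h
        refine le_of_forall_conn (β := Setoid.comap (F ∘ Sum.inr) γ) β.2 ?_ h
        intro j k hjk
        -- A left point `i` joined to `j` by `α` links `f j` and `k` through `γ`.
        obtain ⟨i, hi⟩ := (generalizedLine_iff.1 α.2).2 j
        have := conn_trans (conn_symm (hγ hi (hf j))) (hγ hi hjk)
        exact this
    exact ofDualSymInv_conn.1 (key h)
  · exact DualSymInv.mul_rel_le (toDualSymInv (α * β)).difunctional
      (fun _ _ _ h1 h2 => conn_mul h1 h2) h

/-- The map `toDualSymInv` as a homomorphism of monoids. -/
def toDualSymInvHom (n : ℕ) : IP n →* DualSymInv (Fin n) where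
  toFun := toDualSymInv
  map_one' := rfl
  map_mul' := toDualSymInv_mul

/-- The isomorphism of `𝓘𝓟_n` onto the dual symmetric inverse monoid. -/
noncomputable def dualSymInvEquiv (n : ℕ) : IP n ≃* DualSymInv (Fin n) :=
  MulEquiv.ofBijective (toDualSymInvHom n)
    ⟨toDualSymInv_injective, fun R => ⟨⟨_, ofDualSymInv_mem R⟩,
      DualSymInv.ext (funext₂ fun _ _ => propext ofDualSymInv_conn)⟩⟩

end PartitionMonoid

open PartitionMonoid

/-! ### The image of `IT n` in the dual symmetric inverse monoid. -/

theorem IT_le_IP (n : ℕ) : IT n ≤ IP n := fun _ h X hX => (h X hX).1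

theorem mem_IT_iff {n : ℕ} (α : IP n) :
    α.1 ∈ IT n ↔ dualSymInvEquiv n α ∈ DualSymInv.balanced (Fin n) :=
  balanced_iff

theorem map_IT (n : ℕ) : ((IT n).comap (IP n).subtype).map (dualSymInvEquiv n).toMonoidHom =
    DualSymInv.balanced (Fin n) := by
  ext R
  constructor
  · rintro ⟨α, hα, rfl⟩
    exact (mem_IT_iff α).1 hα
  · intro hR
    obtain ⟨α, rfl⟩ := (dualSymInvEquiv n).surjective R
    exact ⟨α, (mem_IT_iff α).2 hR, rfl⟩

/-- The embedding of `𝓘𝓣_n` into the dual symmetric inverse monoid. -/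
noncomputable def embIT (n : ℕ) : IT n →* DualSymInv (Fin n) :=
  (dualSymInvEquiv n).toMonoidHom.comp (Submonoid.inclusion (IT_le_IP n))

theorem embIT_injective (n : ℕ) : Function.Injective (embIT n) :=
  (dualSymInvEquiv n).injective.comp (Submonoid.inclusion_injective (IT_le_IP n))

theorem embIT_mem_balanced {n : ℕ} (α : IT n) : embIT n α ∈ DualSymInv.balanced (Fin n) :=
  (mem_IT_iff ⟨α.1, IT_le_IP n α.2⟩).1 α.2

end BrauerType

namespace BrauerType

open DualSymInv

/-! ### Equivalence relations generated by one pair -/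

/-- The smallest equivalence relation that relates `a` and `b`. -/
def pairSetoid {X : Type*} (a b : X) : Setoid X :=
  Relation.EqvGen.setoid fun x y => x = a ∧ y = b

section pairSetoid

variable {X : Type*}

theorem pairSetoid_le {a b : X} {r : Setoid X} : pairSetoid a b ≤ r ↔ r a b := by
  refine ⟨fun h => h (Relation.EqvGen.rel _ _ ⟨rfl, rfl⟩), fun h => Setoid.eqvGen_le ?_⟩
  rintro x y ⟨rfl, rfl⟩
  exact h

theorem pairSetoid_self (a b : X) : pairSetoid a b a b := pairSetoid_le.1 le_rfl

theorem pairSetoid_comm (a b : X) : pairSetoid a b = pairSetoid b a :=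
  le_antisymm (pairSetoid_le.2 (Setoid.symm' _ (pairSetoid_self b a)))
    (pairSetoid_le.2 (Setoid.symm' _ (pairSetoid_self a b)))

theorem pairSetoid_refl (a : X) : pairSetoid a a = ⊥ :=
  le_bot_iff.1 (pairSetoid_le.2 (Setoid.refl' _ a))

theorem pairSetoid_comap (p : Equiv.Perm X) (a b : X) :
    (pairSetoid a b).comap p.symm = pairSetoid (p a) (p b) := by
  apply le_antisymm
  · intro x y h
    have : pairSetoid a b ≤ (pairSetoid (p a) (p b)).comap p :=
      pairSetoid_le.2 (pairSetoid_self (p a) (p b))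
    simpa [Setoid.comap_rel] using this h
  · rw [pairSetoid_le, Setoid.comap_rel, Equiv.symm_apply_apply, Equiv.symm_apply_apply]
    exact pairSetoid_self a b

theorem ofPerm_mul_pairSetoid (p : Equiv.Perm X) (a b : X) :
    ofPerm p * ofSetoid (pairSetoid a b) = ofSetoid (pairSetoid (p a) (p b)) * ofPerm p := by
  rw [ofPerm_mul_ofSetoid, pairSetoid_comap]

theorem rel_swap [DecidableEq X] {r : Setoid X} {a b : X} (h : r a b) (x : X) :
    r x (Equiv.swap a b x) := by
  rw [Equiv.swap_apply_def]
  split_ifs with h1 h2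
  · exact h1 ▸ h
  · exact h2 ▸ r.symm h
  · exact r.refl x

end pairSetoid

/-! ### The homomorphism from `T` to `𝓘𝓣_n` -/

variable {n : ℕ}

/-- The transposition of two neighbouring points. -/
def adj (i : Fin (n - 1)) : Equiv.Perm (Fin n) := Equiv.swap (lo i) (hi i)

/-- The block of `a` contains the point `(adj i a)'`, whereas `ofPerm` relates `p b` to `b`; the two
conventions agree because a transposition is its own inverse. -/
theorem embIT_s (i : Fin (n - 1)) : embIT n (s i) = ofPerm (adj i) := by
  refine DualSymInv.ext (funext₂ fun a b => propext ?_)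
  change adj i a = b ↔ a = adj i b
  rw [adj, Equiv.swap_apply_eq_iff]

theorem embIT_rho (i : Fin (n - 1)) :
    embIT n (rho i) = ofSetoid (pairSetoid (lo i) (hi i)) := by
  have : Setoid.ker (collapse i) = pairSetoid (lo i) (hi i) := by
    apply le_antisymm
    · have key : ∀ x, pairSetoid (lo i) (hi i) x (collapse i x) := fun x => by
        unfold collapse
        split_ifs with h
        · rw [h]
          exact Setoid.symm' _ (pairSetoid_self _ _)
        · exact Setoid.refl' _ x
      intro x y h
      have h' : collapse i x = collapse i y := h
      exact Setoid.trans' _ (h' ▸ key x) (Setoid.symm' _ (key y))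
    · rw [pairSetoid_le]
      change collapse i (lo i) = collapse i (hi i)
      simp [collapse]
  rw [← this]
  rfl

theorem adj_mul_self (i : Fin (n - 1)) : adj i * adj i = 1 := Equiv.swap_mul_self _ _

theorem adj_apply_lo (i : Fin (n - 1)) : adj i (lo i) = hi i := Equiv.swap_apply_left _ _

theorem adj_apply_hi (i : Fin (n - 1)) : adj i (hi i) = lo i := Equiv.swap_apply_right _ _

theorem adj_apply_of_ne {i : Fin (n - 1)} {x : Fin n} (h1 : x.1 ≠ i.1) (h2 : x.1 ≠ i.1 + 1) :
    adj i x = x :=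
  Equiv.swap_apply_of_ne_of_ne (fun h => h1 (congrArg Fin.val h)) fun h => h2 (congrArg Fin.val h)

theorem Far.symm {i j : Fin (n - 1)} (h : Far i j) : Far j i := Or.symm h

/-- Both pairs are the two outer ones among three consecutive points. -/
theorem Near.apply_eq {i j : Fin (n - 1)} (h : Near i j) :
    pairSetoid (adj i (lo j)) (adj i (hi j)) = pairSetoid (adj j (lo i)) (adj j (hi i)) := by
  have key : ∀ i j : Fin (n - 1), i.1 + 1 = j.1 →
      pairSetoid (adj i (lo j)) (adj i (hi j)) = pairSetoid (adj j (lo i)) (adj j (hi i)) := by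
    intro i j h
    have e : lo j = hi i := Fin.ext h.symm
    rw [e, adj_apply_hi, adj_apply_of_ne (x := hi j) (by simp [hi]; omega) (by simp [hi]; omega),
      ← e, adj_apply_lo, adj_apply_of_ne (x := lo i) (by simp [lo]; omega) (by simp [lo]; omega)]
  rcases h with h | h
  · exact key i j h
  · exact (key j i h).symm

theorem Far.adj_lo {i j : Fin (n - 1)} (h : Far i j) : adj i (lo j) = lo j :=
  adj_apply_of_ne (by rcases h with h | h <;> simp [lo] <;> omega)
    (by rcases h with h | h <;> simp [lo] <;> omega)

theorem Far.adj_hi {i j : Fin (n - 1)} (h : Far i j) : adj i (hi j) = hi j :=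
  adj_apply_of_ne (by rcases h with h | h <;> simp [hi] <;> omega)
    (by rcases h with h | h <;> simp [hi] <;> omega)

theorem mul_adj_eq (p : Equiv.Perm (Fin n)) (i : Fin (n - 1)) :
    p * adj i = Equiv.swap (p (lo i)) (p (hi i)) * p := by
  rw [adj, Equiv.mul_swap_eq_swap_mul]

theorem Far.adj_comm {i j : Fin (n - 1)} (h : Far i j) : adj i * adj j = adj j * adj i := by
  rw [mul_adj_eq, h.adj_lo, h.adj_hi, ← adj]

theorem Near.braid {i j : Fin (n - 1)} (h : Near i j) :
    adj i * adj j * adj i = adj j * adj i * adj j := by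
  have key : ∀ i j : Fin (n - 1), i.1 + 1 = j.1 →
      adj i * adj j * adj i = adj j * adj i * adj j := by
    intro i j h
    have e : lo j = hi i := Fin.ext h.symm
    have e1 : adj i (hi j) = hi j := adj_apply_of_ne (by simp [hi]; omega) (by simp [hi]; omega)
    have e2 : adj j (lo i) = lo i := adj_apply_of_ne (by simp [lo]; omega) (by simp [lo]; omega)
    rw [mul_adj_eq (adj i) j, mul_adj_eq (adj j) i, mul_assoc, mul_assoc, adj_mul_self,
      adj_mul_self, e, e1, e2, adj_apply_hi, ← e, adj_apply_lo]
  rcases h with h | h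
  · exact key i j h
  · exact (key j i h).symm

/-- The images of the generators of `T` in `𝓘𝓣_n`. -/
def genIT : Gen n → IT n
  | .sig i => s i
  | .tau i => rho i

/-- Injectivity of `embIT` allows the relations to be checked on permutations and equivalence
relations, where idempotents multiply as joins and conjugation moves the generating pair. -/
theorem genIT_rel (u v : FreeMonoid (Gen n)) (h : Rel n u v) :
    FreeMonoid.lift genIT u = FreeMonoid.lift genIT v := by
  apply embIT_injective n
  have hs : ∀ i : Fin (n - 1), embIT n (FreeMonoid.lift genIT (σ i)) = ofPerm (adj i) := fun i => by
    rw [σ, FreeMonoid.lift_eval_of, genIT, embIT_s]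
  have ht : ∀ i : Fin (n - 1),
      embIT n (FreeMonoid.lift genIT (τ i)) = ofSetoid (pairSetoid (lo i) (hi i)) := fun i => by
    rw [τ, FreeMonoid.lift_eval_of, genIT, embIT_rho]
  have hab : ∀ {r : Setoid (Fin n)} {i : Fin (n - 1)}, r (lo i) (hi i) →
      ofSetoid r * ofPerm (adj i) = ofSetoid r := fun h =>
    ofSetoid_mul_ofPerm_eq_self (rel_swap h)
  cases h with
  | sig_sq i => simp only [map_mul, hs, map_one]; rw [← map_mul, adj_mul_self, map_one]
  | sig_comm i j h => simp only [map_mul, hs]; rw [← map_mul, h.adj_comm, map_mul]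
  | braid i j h => simp only [map_mul, hs]; simp only [← map_mul, h.braid]
  | tau_idem i => simp only [map_mul, ht]; rw [ofSetoid_mul, sup_idem]
  | tau_comm i j h => simp only [map_mul, ht]; rw [ofSetoid_mul, ofSetoid_mul, sup_comm]
  | tau_sig i => simp only [map_mul, ht, hs]; rw [hab (pairSetoid_self _ _)]
  | sig_tau i =>
    simp only [map_mul, ht, hs]
    rw [ofPerm_mul_pairSetoid, adj_apply_lo, adj_apply_hi, pairSetoid_comm,
      hab (pairSetoid_self _ _)]
  | tau_sig_comm i j h =>
    simp only [map_mul, ht, hs]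
    rw [ofPerm_mul_pairSetoid, h.symm.adj_lo, h.symm.adj_hi]
  | sig_tau_sig i j h =>
    simp only [map_mul, ht, hs]
    rw [ofPerm_mul_pairSetoid, ofPerm_mul_pairSetoid, mul_assoc, mul_assoc, ← map_mul, ← map_mul,
      adj_mul_self, adj_mul_self, h.apply_eq]
  | tau_sig_tau i j h =>
    simp only [map_mul, ht, hs]
    rw [mul_assoc, ofPerm_mul_pairSetoid, ← mul_assoc, ofSetoid_mul, ofSetoid_mul]
    -- Either join merges the three consecutive points spanned by `i` and `j`; afterwards the
    -- remaining factor `adj j` moves points only inside a class and is absorbed.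
    have e : pairSetoid (lo i) (hi i) ⊔ pairSetoid (adj j (lo i)) (adj j (hi i)) =
        pairSetoid (lo i) (hi i) ⊔ pairSetoid (lo j) (hi j) := by
      apply le_antisymm
      · refine sup_le le_sup_left (pairSetoid_le.2 ?_)
        set r := pairSetoid (lo i) (hi i) ⊔ pairSetoid (lo j) (hi j)
        have hi' : r (lo i) (hi i) := pairSetoid_le.1 le_sup_left
        have hj' : r (lo j) (hi j) := pairSetoid_le.1 le_sup_right
        exact r.trans (r.symm (rel_swap hj' _)) (r.trans hi' (rel_swap hj' _))
      · refine sup_le le_sup_left (pairSetoid_le.2 ?_)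
        rw [← h.apply_eq]
        set r := pairSetoid (lo i) (hi i) ⊔ pairSetoid (adj i (lo j)) (adj i (hi j))
        have hi' : r (lo i) (hi i) := pairSetoid_le.1 le_sup_left
        have hj' : r (adj i (lo j)) (adj i (hi j)) := pairSetoid_le.1 le_sup_right
        exact r.trans (rel_swap hi' _) (r.trans hj' (r.symm (rel_swap hi' _)))
    rw [e]
    exact hab (pairSetoid_le.1 le_sup_right)

/-- The homomorphism from `T` to `𝓘𝓣_n`. -/
def toIT (n : ℕ) : T n →* IT n := PresentedMonoid.lift genIT genIT_rel

/-- The homomorphism from `T` to the dual symmetric inverse monoid. -/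
noncomputable def toDual (n : ℕ) : T n →* DualSymInv (Fin n) := (embIT n).comp (toIT n)

/-- The generator `σ_i` of `T`. -/
def sg (i : Fin (n - 1)) : T n := PresentedMonoid.of (Rel n) (Gen.sig i)

/-- The generator `τ_i` of `T`. -/
def tg (i : Fin (n - 1)) : T n := PresentedMonoid.of (Rel n) (Gen.tau i)

theorem toDual_sg (i : Fin (n - 1)) : toDual n (sg i) = ofPerm (adj i) := embIT_s i

theorem toDual_tg (i : Fin (n - 1)) :
    toDual n (tg i) = ofSetoid (pairSetoid (lo i) (hi i)) := embIT_rho i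

theorem closure_adj : Submonoid.closure (Set.range (adj : Fin (n - 1) → Equiv.Perm (Fin n))) = ⊤ := by
  cases n with
  | zero => exact Subsingleton.elim _ _
  | succ m => exact Equiv.Perm.mclosure_swap_castSucc_succ m

/-! ### The defining relations as identities in `T n`. -/

theorem eq_of_rel {u v : FreeMonoid (Gen n)} (h : Rel n u v) :
    PresentedMonoid.mk (Rel n) u = PresentedMonoid.mk (Rel n) v :=
  PresentedMonoid.mk_eq_mk_of_rel h

theorem sg_mul_self (i : Fin (n - 1)) : sg i * sg i = 1 := eq_of_rel (.sig_sq i)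

theorem sg_comm {i j : Fin (n - 1)} (h : Far i j) : sg i * sg j = sg j * sg i :=
  eq_of_rel (.sig_comm i j h)

theorem sg_braid {i j : Fin (n - 1)} (h : Near i j) : sg i * sg j * sg i = sg j * sg i * sg j :=
  eq_of_rel (.braid i j h)

theorem tg_mul_self (i : Fin (n - 1)) : tg i * tg i = tg i := eq_of_rel (.tau_idem i)

theorem tg_comm {i j : Fin (n - 1)} (h : i ≠ j) : tg i * tg j = tg j * tg i :=
  eq_of_rel (.tau_comm i j h)

theorem tg_sg (i : Fin (n - 1)) : tg i * sg i = tg i := eq_of_rel (.tau_sig i)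

theorem sg_tg (i : Fin (n - 1)) : sg i * tg i = tg i := eq_of_rel (.sig_tau i)

theorem tg_sg_comm {i j : Fin (n - 1)} (h : Far i j) : tg i * sg j = sg j * tg i :=
  eq_of_rel (.tau_sig_comm i j h)

theorem sg_tg_sg {i j : Fin (n - 1)} (h : Near i j) : sg i * tg j * sg i = sg j * tg i * sg j :=
  eq_of_rel (.sig_tau_sig i j h)

end BrauerType

namespace BrauerType

open DualSymInv

variable {n : ℕ}

/-! ### The subgroup of `T` generated by the `σ_i` -/

/-- The generator `σ_k` of `T`, indexed by the natural numbers, with the value `1` if there is no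
such generator. -/
def sgNat (n k : ℕ) : T n := if h : k < n - 1 then sg ⟨k, h⟩ else 1

theorem sgNat_coe (i : Fin (n - 1)) : sgNat n i.1 = sg i := dif_pos i.2

theorem sgNat_mul_self (k : ℕ) : sgNat n k * sgNat n k = 1 := by
  unfold sgNat
  split_ifs
  · exact sg_mul_self _
  · exact one_mul 1

theorem sgNat_mul_self_mul (k : ℕ) (x : T n) : sgNat n k * (sgNat n k * x) = x := by
  rw [← mul_assoc, sgNat_mul_self, one_mul]

theorem sgNat_comm {i j : ℕ} (h : i + 1 < j) : Commute (sgNat n i) (sgNat n j) := by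
  unfold sgNat
  split_ifs
  · exact sg_comm (Or.inl h)
  all_goals simp

theorem sgNat_braid {i : ℕ} (h : i + 1 < n - 1) :
    sgNat n i * sgNat n (i + 1) * sgNat n i = sgNat n (i + 1) * sgNat n i * sgNat n (i + 1) := by
  rw [sgNat, sgNat, dif_pos h, dif_pos (by omega)]
  exact sg_braid (Or.inl rfl)

theorem isUnit_sgNat (k : ℕ) : IsUnit (sgNat n k) :=
  ⟨⟨_, _, sgNat_mul_self k, sgNat_mul_self k⟩, rfl⟩

/-- The descending product `σ_{j+d-1} ⋯ σ_{j+1} σ_j`. -/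
def desc (n j : ℕ) : ℕ → T n
  | 0 => 1
  | d + 1 => sgNat n (j + d) * desc n j d

theorem isUnit_desc (j d : ℕ) : IsUnit (desc n j d) := by
  induction d with
  | zero => exact isUnit_one
  | succ d ih => exact (isUnit_sgNat _).mul ih

theorem commute_desc_of_lt {i j : ℕ} (h : i + 1 < j) (d : ℕ) :
    Commute (sgNat n i) (desc n j d) := by
  induction d with
  | zero => exact Commute.one_right _
  | succ d ih => exact (sgNat_comm (by omega)).mul_right ih

theorem commute_desc_of_gt {i j d : ℕ} (h : j + d < i) : Commute (sgNat n i) (desc n j d) := by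
  induction d with
  | zero => exact Commute.one_right _
  | succ d ih => exact (sgNat_comm (by omega)).symm.mul_right (ih (by omega))

theorem desc_mul_sgNat (j d : ℕ) : desc n (j + 1) d * sgNat n j = desc n j (d + 1) := by
  induction d with
  | zero => simp [desc]
  | succ d ih => rw [desc, mul_assoc, ih, add_right_comm j 1 d, add_assoc j d 1, desc.eq_2 n j (d + 1)]

/-- A generator that passes leftwards through the run commutes with all factors except two
neighbouring ones, where one braid move lowers its index by one. -/
theorem desc_mul_sgNat_of_mem {j e d : ℕ} (h : e + 1 < d) (hd : j + d ≤ n - 1) :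
    desc n j d * sgNat n (j + e + 1) = sgNat n (j + e) * desc n j d := by
  induction d with
  | zero => omega
  | succ d ih =>
    rcases Nat.lt_or_ge (e + 1) d with h1 | h1
    · rw [desc, mul_assoc, ih h1 (by omega), ← mul_assoc, ← mul_assoc,
        (sgNat_comm (i := j + e) (j := j + d) (by omega)).eq]
    · obtain rfl : d = e + 1 := by omega
      rw [desc, desc, mul_assoc, mul_assoc, ← (commute_desc_of_gt (by omega)).eq]
      have := sgNat_braid (n := n) (i := j + e) (by omega)
      simp only [← mul_assoc, ← add_assoc] at this ⊢
      rw [this]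

/-- The submonoid generated by `σ_i` for `i < k`. -/
def sgSubmonoid (n k : ℕ) : Submonoid (T n) := Submonoid.closure (sgNat n '' Set.Iio k)

theorem sgNat_mem {i k : ℕ} (h : i < k) : sgNat n i ∈ sgSubmonoid n k :=
  Submonoid.subset_closure ⟨i, h, rfl⟩

/-- The descending runs that start at `σ_k` (or are empty) represent all cosets. Right
multiplication by a generator lengthens the run, shortens it, or passes through it into `sgSubmonoid
n k`. -/
theorem exists_eq_mul_desc {k : ℕ} (hk : k + 1 ≤ n - 1) {x : T n} (hx : x ∈ sgSubmonoid n (k + 1)) :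
    ∃ g ∈ sgSubmonoid n k, ∃ j d, j + d = k + 1 ∧ x = g * desc n j d := by
  induction hx using Submonoid.closure_induction_right with
  | one => exact ⟨1, one_mem _, k + 1, 0, rfl, by simp [desc]⟩
  | mul_right x hx y hy ih =>
    obtain ⟨g, hg, j, d, hjd, rfl⟩ := ih
    obtain ⟨i, hi, rfl⟩ := hy
    have hi : i < k + 1 := hi
    rcases Nat.lt_trichotomy (i + 1) j with h | h | h
    · exact ⟨g * sgNat n i, mul_mem hg (sgNat_mem (by omega)), j, d, hjd, by
        rw [mul_assoc, mul_assoc, (commute_desc_of_lt h d).eq]⟩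
    · subst h
      exact ⟨g, hg, i, d + 1, by omega, by rw [mul_assoc, desc_mul_sgNat]⟩
    · rcases (Nat.lt_succ_iff.1 h).eq_or_lt with rfl | h
      · obtain ⟨d, rfl⟩ : ∃ d', d = d' + 1 := ⟨d - 1, by omega⟩
        exact ⟨g, hg, j + 1, d, by omega, by
          rw [← desc_mul_sgNat, mul_assoc, mul_assoc, sgNat_mul_self, mul_one]⟩
      · obtain ⟨e, rfl⟩ : ∃ e, i = j + e + 1 := ⟨i - j - 1, by omega⟩
        exact ⟨g * sgNat n (j + e), mul_mem hg (sgNat_mem (by omega)), j, d, hjd, by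
          rw [mul_assoc, mul_assoc, desc_mul_sgNat_of_mem (by omega) (by omega)]⟩

/-- The last of the allowed transpositions exchanges `k - 1` and `k`, so the point `k` itself may
move. -/
theorem exists_toDual_of_mem {k : ℕ} {x : T n} (hx : x ∈ sgSubmonoid n k) :
    ∃ p : Equiv.Perm (Fin n), toDual n x = ofPerm p ∧ ∀ a : Fin n, k < a.1 → p a = a := by
  induction hx using Submonoid.closure_induction with
  | mem x hx =>
    obtain ⟨i, hi, rfl⟩ := hx
    have hi : i < k := hi
    unfold sgNat
    split_ifs with h
    · exact ⟨adj ⟨i, h⟩, toDual_sg _, fun a ha => adj_apply_of_ne (by simp; omega) (by simp; omega)⟩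
    · exact ⟨1, by rw [map_one, map_one], fun _ _ => rfl⟩
  | one => exact ⟨1, by rw [map_one, map_one], fun _ _ => rfl⟩
  | mul x y _ _ hx hy =>
    obtain ⟨p, h1, h2⟩ := hx
    obtain ⟨q, k1, k2⟩ := hy
    exact ⟨p * q, by rw [map_mul, map_mul, h1, k1], fun a ha => by
      rw [Equiv.Perm.mul_apply, k2 a ha, h2 a ha]⟩

theorem exists_toDual_desc {j d : ℕ} (h : j + d ≤ n - 1) :
    ∃ p : Equiv.Perm (Fin n), toDual n (desc n j d) = ofPerm p ∧
      ∀ a b : Fin n, a.1 = j → b.1 = j + d → p a = b := by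
  induction d with
  | zero => exact ⟨1, by rw [desc, map_one, map_one], fun a b ha hb => Fin.ext (by simp [ha, hb])⟩
  | succ d ih =>
    obtain ⟨p, h1, h2⟩ := ih (by omega)
    have hlt : j + d < n - 1 := by omega
    refine ⟨adj ⟨j + d, hlt⟩ * p, ?_, fun a b ha hb => ?_⟩
    · rw [desc, map_mul, map_mul, h1, sgNat, dif_pos hlt, toDual_sg]
    · rw [Equiv.Perm.mul_apply, h2 a (lo ⟨j + d, hlt⟩) ha rfl, adj_apply_lo]
      exact Fin.ext hb.symm

/-- The Coxeter relations suffice for the symmetric group. In the coset form, `g` fixes the point `k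
+ 1` and the run sends `j` there, so the image determines `j`; the run is a unit and cancels, which
leaves the case of `k`. -/
theorem toDual_injOn {k : ℕ} (hk : k ≤ n - 1) {x y : T n} (hx : x ∈ sgSubmonoid n k)
    (hy : y ∈ sgSubmonoid n k) (h : toDual n x = toDual n y) : x = y := by
  induction k generalizing x y with
  | zero =>
    have h0 : sgSubmonoid n 0 = ⊥ := by simp [sgSubmonoid]
    rw [h0, Submonoid.mem_bot] at hx hy
    rw [hx, hy]
  | succ k ih =>
    obtain ⟨g, hg, j, d, hjd, rfl⟩ := exists_eq_mul_desc hk hx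
    obtain ⟨g', hg', j', d', hjd', rfl⟩ := exists_eq_mul_desc hk hy
    have hj : j = j' := by
      obtain ⟨p, h1, h2⟩ := exists_toDual_of_mem hg
      obtain ⟨p', h1', h2'⟩ := exists_toDual_of_mem hg'
      obtain ⟨q, k1, k2⟩ := exists_toDual_desc (n := n) (j := j) (d := d) (by omega)
      obtain ⟨q', k1', k2'⟩ := exists_toDual_desc (n := n) (j := j') (d := d') (by omega)
      have e : p * q = p' * q' := by
        apply ofPerm_injective
        rw [map_mul, map_mul, ← h1, ← k1, ← h1', ← k1', ← map_mul, ← map_mul, h]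
      let a : Fin n := ⟨j, by omega⟩
      let a' : Fin n := ⟨j', by omega⟩
      let b : Fin n := ⟨k + 1, by omega⟩
      have e1 : (p * q) a = b := by
        rw [Equiv.Perm.mul_apply, k2 a b rfl hjd.symm, h2 b (Nat.lt_succ_self k)]
      have e2 : (p * q) a' = b := by
        rw [e, Equiv.Perm.mul_apply, k2' a' b rfl hjd'.symm, h2' b (Nat.lt_succ_self k)]
      exact congrArg Fin.val ((p * q).injective (e1.trans e2.symm))
    subst hj
    obtain rfl : d = d' := by omega
    rw [ih (by omega) hg hg']
    have hu : IsUnit (toDual n (desc n j d)) := (isUnit_desc j d).map (toDual n)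
    rw [map_mul, map_mul] at h
    exact hu.mul_left_injective h

theorem exists_mem_toDual_eq (p : Equiv.Perm (Fin n)) :
    ∃ x ∈ sgSubmonoid n (n - 1), toDual n x = ofPerm p := by
  have hp : p ∈ Submonoid.closure (Set.range (adj : Fin (n - 1) → Equiv.Perm (Fin n))) := by
    rw [closure_adj]
    trivial
  induction hp using Submonoid.closure_induction with
  | mem p hp =>
    obtain ⟨i, rfl⟩ := hp
    exact ⟨sg i, sgNat_coe i ▸ sgNat_mem i.2, toDual_sg i⟩
  | one => exact ⟨1, one_mem _, by rw [map_one, map_one]⟩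
  | mul p q _ _ hp hq =>
    obtain ⟨x, h1, h2⟩ := hp
    obtain ⟨y, k1, k2⟩ := hq
    exact ⟨x * y, mul_mem h1 k1, by rw [map_mul, map_mul, h2, k2]⟩

/-- The embedding of the symmetric group into `T`. -/
noncomputable def permT (n : ℕ) : Equiv.Perm (Fin n) →* T n where
  -- By `toDual_injOn` the chosen preimage is the only one in the submonoid, which is why the choice
  -- is multiplicative.
  toFun p := (exists_mem_toDual_eq p).choose
  map_one' := by
    have h := (exists_mem_toDual_eq (1 : Equiv.Perm (Fin n))).choose_spec
    exact toDual_injOn le_rfl h.1 (one_mem _) (by rw [h.2, map_one, map_one])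
  map_mul' p q := by
    have h := (exists_mem_toDual_eq (p * q)).choose_spec
    have hp := (exists_mem_toDual_eq p).choose_spec
    have hq := (exists_mem_toDual_eq q).choose_spec
    exact toDual_injOn le_rfl h.1 (mul_mem hp.1 hq.1) (by rw [h.2, map_mul, map_mul, hp.2, hq.2])

theorem toDual_permT (p : Equiv.Perm (Fin n)) : toDual n (permT n p) = ofPerm p :=
  (exists_mem_toDual_eq p).choose_spec.2

theorem permT_adj (i : Fin (n - 1)) : permT n (adj i) = sg i :=
  toDual_injOn le_rfl (exists_mem_toDual_eq (adj i)).choose_spec.1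
    (sgNat_coe i ▸ sgNat_mem i.2) (by rw [toDual_permT, toDual_sg])

/-! ### The conjugates of the `τ_i` -/

/-- The generator `τ_k` of `T`, indexed by the natural numbers. -/
def tgNat (n k : ℕ) : T n := if h : k < n - 1 then tg ⟨k, h⟩ else 1

theorem tgNat_coe (i : Fin (n - 1)) : tgNat n i.1 = tg i := dif_pos i.2

/-- The conjugate of `τ_a` that corresponds to the pair of points `a`, `a + d + 1`. -/
def conjTau (n a : ℕ) : ℕ → T n
  | 0 => tgNat n a
  | d + 1 => sgNat n (a + d + 1) * conjTau n a d * sgNat n (a + d + 1)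

theorem commute_conjTau {i a d : ℕ} (h : i + 1 < a ∨ a + d + 1 < i) :
    Commute (sgNat n i) (conjTau n a d) := by
  induction d with
  | zero =>
    unfold conjTau sgNat tgNat
    split_ifs
    · exact (tg_sg_comm (h.elim Or.inr Or.inl)).symm
    all_goals simp
  | succ d ih =>
    have : Commute (sgNat n i) (sgNat n (a + d + 1)) := by
      rcases h with h | h
      · exact sgNat_comm (by omega)
      · exact (sgNat_comm (by omega)).symm
    exact (this.mul_right (ih (by omega))).mul_right this

theorem sgNat_conj_conj (i : ℕ) (x : T n) :
    sgNat n i * (sgNat n i * x * sgNat n i) * sgNat n i = x := by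
  simp only [mul_assoc, sgNat_mul_self_mul, sgNat_mul_self, mul_one]

theorem conj_eq_of_commute {i : ℕ} {x : T n} (h : Commute (sgNat n i) x) :
    sgNat n i * x * sgNat n i = x := by
  rw [h.eq, mul_assoc, sgNat_mul_self, mul_one]

theorem conj_top {a : ℕ} (ha : a < n - 1) :
    sgNat n a * conjTau n a 0 * sgNat n a = conjTau n a 0 := by
  rw [conjTau, tgNat, sgNat, dif_pos ha, dif_pos ha, sg_tg, tg_sg]

/-- Moving the lower end down has the same effect as moving the upper end up. For adjacent points
this is the relation between `σ_a τ_{a+1} σ_a` and `σ_{a+1} τ_a σ_{a+1}`; in the inductive step two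
distant generators commute. -/
theorem conj_bottom {a d : ℕ} (h : a + 1 + d < n - 1) :
    sgNat n a * conjTau n (a + 1) d * sgNat n a = conjTau n a (d + 1) := by
  induction d with
  | zero =>
    simp only [conjTau, tgNat, sgNat]
    rw [dif_pos (show a < n - 1 by omega), dif_pos (show a + 1 < n - 1 by omega),
      dif_pos (show a < n - 1 by omega), dif_pos (show a + 0 + 1 < n - 1 by omega)]
    exact sg_tg_sg (Or.inl rfl)
  | succ d ih =>
    rw [conjTau, conjTau, ← ih (by omega)]
    have e : a + 1 + d + 1 = a + (d + 1) + 1 := by omega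
    have hc := sgNat_comm (n := n) (i := a) (j := a + (d + 1) + 1) (by omega)
    rw [e]
    simp only [← mul_assoc]
    rw [hc.eq]
    simp only [mul_assoc]
    rw [hc.eq]

/-- The generator exchanges two points strictly between the ends. At the innermost stage a braid
move turns it into one that commutes with the shorter conjugate. -/
theorem conj_middle {a e d : ℕ} (h : e + 1 < d) (hd : a + d < n - 1) :
    sgNat n (a + e + 1) * conjTau n a d * sgNat n (a + e + 1) = conjTau n a d := by
  induction d with
  | zero => omega
  | succ d ih =>
    rcases Nat.lt_or_ge (e + 1) d with h1 | h1
    · have hc := sgNat_comm (n := n) (i := a + e + 1) (j := a + d + 1) (by omega)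
      rw [conjTau]
      conv_rhs => rw [← ih h1 (by omega)]
      simp only [← mul_assoc]
      rw [hc.eq]
      simp only [mul_assoc]
      rw [hc.eq]
    · obtain rfl : d = e + 1 := by omega
      have hc := commute_conjTau (n := n) (i := a + e + 1 + 1) (a := a) (d := e) (by omega)
      have hb := sgNat_braid (n := n) (i := a + e + 1) (by omega)
      rw [conjTau, conjTau, ← add_assoc]
      set u := sgNat n (a + e + 1)
      set v := sgNat n (a + e + 1 + 1)
      set x := conjTau n a e
      calc u * (v * (u * x * u) * v) * u = (u * v * u) * x * (u * v * u) := by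
            simp only [mul_assoc]
        _ = (v * u * v) * x * (v * u * v) := by rw [hb]
        _ = v * u * (v * x * v) * u * v := by simp only [mul_assoc]
        _ = v * (u * x * u) * v := by rw [conj_eq_of_commute hc]; simp only [mul_assoc]

/-- The conjugate of the `τ_i` that corresponds to the unordered pair of points `x` and `y`. -/
def tauNat (n x y : ℕ) : T n :=
  if x < y then conjTau n x (y - x - 1) else if y < x then conjTau n y (x - y - 1) else 1

theorem tauNat_comm (x y : ℕ) : tauNat n x y = tauNat n y x := by
  unfold tauNat
  rcases Nat.lt_trichotomy x y with h | rfl | h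
  · rw [if_pos h, if_neg (by omega), if_pos h]
  · rfl
  · rw [if_neg (by omega), if_pos h, if_pos h]

theorem tauNat_self (x : ℕ) : tauNat n x x = 1 := by simp [tauNat]

theorem tauNat_eq {x y d : ℕ} (h : y = x + d + 1) : tauNat n x y = conjTau n x d := by
  rw [tauNat, if_pos (by omega), show y - x - 1 = d by omega]

/-- The transposition of `i` and `i + 1`. -/
def adjNat (i x : ℕ) : ℕ := if x = i then i + 1 else if x = i + 1 then i else x

/-- The heart of the claim that the conjugates depend only on the pair. The cases are the positions
of `i`, `i + 1` relative to `x < y`: disjoint from both ends (outside or between), touching one end,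
or equal to the pair. -/
theorem tauNat_adjNat_of_lt {i x y : ℕ} (hi : i < n - 1) (hy : y ≤ n - 1) (hxy : x < y) :
    tauNat n (adjNat i x) (adjNat i y) = sgNat n i * tauNat n x y * sgNat n i := by
  obtain ⟨d, rfl⟩ : ∃ d, y = x + d + 1 := ⟨y - x - 1, by omega⟩
  rw [tauNat_eq (x := x) rfl]
  unfold adjNat
  rcases Nat.lt_trichotomy (i + 1) x with h | h | h
  · rw [if_neg (by omega), if_neg (by omega), if_neg (by omega), if_neg (by omega), tauNat_eq rfl,
      conj_eq_of_commute (commute_conjTau (Or.inl h))]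
  · subst h
    rw [if_neg (by omega), if_pos rfl, if_neg (by omega), if_neg (by omega),
      tauNat_eq (d := d + 1) (by omega), conj_bottom (by omega)]
  · obtain ⟨e, rfl⟩ : ∃ e, i = x + e := ⟨i - x, by omega⟩
    rcases Nat.lt_trichotomy e d with h | rfl | h
    · cases e with
      | zero =>
        obtain ⟨d, rfl⟩ : ∃ d', d = d' + 1 := ⟨d - 1, by omega⟩
        rw [if_pos (by omega), if_neg (by omega), if_neg (by omega), tauNat_eq (d := d) (by omega),
          ← conj_bottom (by omega), add_zero, sgNat_conj_conj]
      | succ e =>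
        rw [if_neg (by omega), if_neg (by omega), if_neg (by omega), if_neg (by omega),
          tauNat_eq rfl]
        exact (conj_middle h (by omega)).symm
    · cases e with
      | zero =>
        rw [if_pos (by omega), if_neg (by omega), if_pos (by omega), tauNat_comm,
          tauNat_eq (x := x + 0) (y := x + 0 + 1) (d := 0) rfl, add_zero, conj_top (a := x) hi]
      | succ e =>
        rw [if_neg (by omega), if_neg (by omega), if_neg (by omega), if_pos rfl,
          tauNat_eq (d := e) (by omega), conjTau, ← add_assoc, sgNat_conj_conj]
    · rcases (Nat.succ_le_of_lt h).eq_or_lt with rfl | h1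
      · rw [if_neg (by omega), if_neg (by omega), if_pos (by omega), tauNat_eq (d := d + 1) (by omega),
          conjTau]
        rfl
      · rw [if_neg (by omega), if_neg (by omega), if_neg (by omega), if_neg (by omega),
          tauNat_eq rfl, conj_eq_of_commute (commute_conjTau (Or.inr (by omega)))]

theorem tauNat_adjNat {i x y : ℕ} (hi : i < n - 1) (hx : x ≤ n - 1) (hy : y ≤ n - 1) :
    tauNat n (adjNat i x) (adjNat i y) = sgNat n i * tauNat n x y * sgNat n i := by
  rcases Nat.lt_trichotomy x y with h | rfl | h
  · exact tauNat_adjNat_of_lt hi hy h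
  · rw [tauNat_self, tauNat_self, mul_one, sgNat_mul_self]
  · rw [tauNat_comm, tauNat_adjNat_of_lt hi hx h, tauNat_comm]

/-- The conjugate of the `τ_i` that corresponds to the unordered pair `{a, b}`; it is `1` if
`a = b`. -/
def pairTau (a b : Fin n) : T n := tauNat n a b

theorem pairTau_comm (a b : Fin n) : pairTau a b = pairTau b a := tauNat_comm _ _

theorem pairTau_self (a : Fin n) : pairTau a a = 1 := tauNat_self _

theorem pairTau_lo_hi (i : Fin (n - 1)) : pairTau (lo i) (hi i) = tg i := by
  rw [pairTau, tauNat_eq (x := (lo i).1) (y := (hi i).1) (d := 0) rfl, conjTau]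
  exact tgNat_coe i

theorem coe_adj_apply (i : Fin (n - 1)) (x : Fin n) : (adj i x).1 = adjNat i x := by
  unfold adjNat
  rw [adj, Equiv.swap_apply_def]
  simp only [Fin.ext_iff, lo, hi]
  split_ifs <;> rfl

theorem pairTau_adj (i : Fin (n - 1)) (a b : Fin n) :
    pairTau (adj i a) (adj i b) = sg i * pairTau a b * sg i := by
  rw [pairTau, coe_adj_apply, coe_adj_apply, tauNat_adjNat i.2 (by omega) (by omega), sgNat_coe]
  rfl

/-- This equivariance reduces an identity between the `pairTau` to one convenient position of the
points. -/
theorem permT_mul_pairTau (p : Equiv.Perm (Fin n)) (a b : Fin n) :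
    permT n p * pairTau a b = pairTau (p a) (p b) * permT n p := by
  have hp : p ∈ Submonoid.closure (Set.range (adj : Fin (n - 1) → Equiv.Perm (Fin n))) := by
    rw [closure_adj]
    trivial
  induction hp using Submonoid.closure_induction generalizing a b with
  | mem p hp =>
    obtain ⟨i, rfl⟩ := hp
    rw [pairTau_adj, permT_adj, mul_assoc, mul_assoc, sg_mul_self, mul_one]
  | one => rw [map_one, one_mul, mul_one]; rfl
  | mul p q _ _ hp hq =>
    rw [map_mul, mul_assoc, hq, ← mul_assoc, hp, mul_assoc]
    rfl

/-- Conjugation by the image of a permutation. -/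
noncomputable def conjPermT (p : Equiv.Perm (Fin n)) : T n →* T n where
  toFun x := permT n p * x * permT n p⁻¹
  map_one' := by rw [mul_one, ← map_mul, mul_inv_cancel, map_one]
  map_mul' x y := by
    have : permT n p⁻¹ * permT n p = 1 := by rw [← map_mul, inv_mul_cancel, map_one]
    calc _ = permT n p * x * 1 * y * permT n p⁻¹ := by simp only [mul_assoc, one_mul]
      _ = _ := by rw [← this]; simp only [mul_assoc]

theorem conjPermT_pairTau (p : Equiv.Perm (Fin n)) (a b : Fin n) :
    conjPermT p (pairTau a b) = pairTau (p a) (p b) := by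
  change permT n p * pairTau a b * permT n p⁻¹ = _
  rw [permT_mul_pairTau, mul_assoc, ← map_mul, mul_inv_cancel, map_one, mul_one]

theorem conjPermT_permT (p q : Equiv.Perm (Fin n)) :
    conjPermT p (permT n q) = permT n (p * q * p⁻¹) := by
  rw [map_mul, map_mul]
  rfl

/-! ### Transport of the relations from neighbouring points to arbitrary ones. -/

theorem exists_perm_pair {a b : Fin n} (h : a ≠ b) :
    ∃ (i : Fin (n - 1)) (p : Equiv.Perm (Fin n)), p (lo i) = a ∧ p (hi i) = b := by
  have hn : 0 < n - 1 := by omega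
  obtain ⟨p, hp⟩ := Equiv.Perm.exists_extending_pair ![lo ⟨0, hn⟩, hi ⟨0, hn⟩] ![a, b]
    (by intro x y; fin_cases x <;> fin_cases y <;> simp [lo, hi])
    (by intro x y; fin_cases x <;> fin_cases y <;> simp [h, h.symm])
  exact ⟨_, p, hp 0, hp 1⟩

theorem exists_perm_triple {a b c : Fin n} (hab : a ≠ b) (hac : a ≠ c) (hbc : b ≠ c) :
    ∃ (i j : Fin (n - 1)) (p : Equiv.Perm (Fin n)), i.1 + 1 = j.1 ∧
      p (lo i) = a ∧ p (hi i) = b ∧ p (lo j) = b ∧ p (hi j) = c := by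
  have hn : 1 < n - 1 := by omega
  obtain ⟨p, hp⟩ := Equiv.Perm.exists_extending_pair
    ![lo ⟨0, by omega⟩, lo ⟨1, hn⟩, hi ⟨1, hn⟩] ![a, b, c]
    (by intro x y; fin_cases x <;> fin_cases y <;> simp [lo, hi])
    (by intro x y; fin_cases x <;> fin_cases y <;>
          simp [hab, hac, hbc, hab.symm, hac.symm, hbc.symm])
  exact ⟨⟨0, by omega⟩, ⟨1, hn⟩, p, rfl, hp 0, hp 1, hp 1, hp 2⟩

theorem exists_perm_quadruple {a b c d : Fin n} (hab : a ≠ b) (hac : a ≠ c) (had : a ≠ d)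
    (hbc : b ≠ c) (hbd : b ≠ d) (hcd : c ≠ d) :
    ∃ (i j : Fin (n - 1)) (p : Equiv.Perm (Fin n)), i ≠ j ∧
      p (lo i) = a ∧ p (hi i) = b ∧ p (lo j) = c ∧ p (hi j) = d := by
  have hn : 2 < n - 1 := by omega
  obtain ⟨p, hp⟩ := Equiv.Perm.exists_extending_pair
    ![lo ⟨0, by omega⟩, hi ⟨0, by omega⟩, lo ⟨2, hn⟩, hi ⟨2, hn⟩] ![a, b, c, d]
    (by intro x y; fin_cases x <;> fin_cases y <;> simp [lo, hi])
    (by intro x y; fin_cases x <;> fin_cases y <;>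
          simp [hab, hac, had, hbc, hbd, hcd, hab.symm, hac.symm, had.symm, hbc.symm, hbd.symm,
            hcd.symm])
  exact ⟨⟨0, by omega⟩, ⟨2, hn⟩, p, by simp, hp 0, hp 1, hp 2, hp 3⟩

theorem toDual_pairTau (a b : Fin n) : toDual n (pairTau a b) = ofSetoid (pairSetoid a b) := by
  rcases eq_or_ne a b with rfl | h
  · rw [pairTau_self, map_one, pairSetoid_refl, ofSetoid_bot]
  · obtain ⟨i, p, rfl, rfl⟩ := exists_perm_pair h
    rw [← conjPermT_pairTau, pairTau_lo_hi]
    change toDual n (permT n p * tg i * permT n p⁻¹) = _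
    rw [map_mul, map_mul, toDual_permT, toDual_permT, toDual_tg, ofPerm_mul_pairSetoid, mul_assoc,
      ← map_mul, mul_inv_cancel, map_one, mul_one]

theorem pairTau_mul_swap (a b : Fin n) :
    pairTau a b * permT n (Equiv.swap a b) = pairTau a b := by
  rcases eq_or_ne a b with rfl | h
  · rw [Equiv.swap_self]
    exact (congrArg _ (map_one _)).trans (mul_one _)
  · obtain ⟨i, p, rfl, rfl⟩ := exists_perm_pair h
    have e : Equiv.swap (p (lo i)) (p (hi i)) = p * adj i * p⁻¹ := by
      rw [mul_adj_eq, mul_assoc, mul_inv_cancel, mul_one]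
    rw [e, ← conjPermT_pairTau, ← conjPermT_permT, ← map_mul, pairTau_lo_hi, permT_adj, tg_sg]

theorem pairTau_mul_self (a b : Fin n) : pairTau a b * pairTau a b = pairTau a b := by
  rcases eq_or_ne a b with rfl | h
  · rw [pairTau_self, one_mul]
  · obtain ⟨i, p, rfl, rfl⟩ := exists_perm_pair h
    rw [← conjPermT_pairTau, ← map_mul, pairTau_lo_hi, tg_mul_self]

theorem pairTau_commute_of_common (a b c : Fin n) : Commute (pairTau a b) (pairTau b c) := by
  rcases eq_or_ne a b with rfl | hab
  · rw [pairTau_self]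
    exact Commute.one_left _
  rcases eq_or_ne b c with rfl | hbc
  · rw [pairTau_self]
    exact Commute.one_right _
  rcases eq_or_ne a c with rfl | hac
  · rw [pairTau_comm]
  obtain ⟨i, j, p, hij, ha, hb, hb', hc⟩ := exists_perm_triple hab hac hbc
  have h1 : pairTau a b = conjPermT p (tg i) := by
    rw [← pairTau_lo_hi, conjPermT_pairTau, ha, hb]
  have h2 : pairTau b c = conjPermT p (tg j) := by
    rw [← pairTau_lo_hi, conjPermT_pairTau, hb', hc]
  rw [h1, h2]
  have hne : i ≠ j := by rintro rfl; omega
  exact Commute.map (show Commute (tg i) (tg j) from tg_comm hne) (conjPermT p)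

theorem pairTau_commute (a b c d : Fin n) : Commute (pairTau a b) (pairTau c d) := by
  rcases eq_or_ne a b with rfl | hab
  · rw [pairTau_self]
    exact Commute.one_left _
  rcases eq_or_ne c d with rfl | hcd
  · rw [pairTau_self]
    exact Commute.one_right _
  rcases eq_or_ne b c with rfl | hbc
  · exact pairTau_commute_of_common a b d
  rcases eq_or_ne a c with rfl | hac
  · rw [pairTau_comm a b]
    exact pairTau_commute_of_common b a d
  rcases eq_or_ne b d with rfl | hbd
  · rw [pairTau_comm c b]
    exact pairTau_commute_of_common a b c
  rcases eq_or_ne a d with rfl | had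
  · rw [pairTau_comm a b, pairTau_comm c a]
    exact pairTau_commute_of_common b a c
  obtain ⟨i, j, p, hij, rfl, rfl, rfl, rfl⟩ := exists_perm_quadruple hab hac had hbc hbd hcd
  rw [← conjPermT_pairTau, ← conjPermT_pairTau, pairTau_lo_hi, pairTau_lo_hi]
  exact Commute.map (show Commute (tg i) (tg j) from tg_comm hij) (conjPermT p)

/-- Once `a`, `b` and `b`, `c` are merged, merging `a`, `c` adds nothing. On consecutive points the
third factor is `σ_j τ_i σ_j`, and `τ_j` absorbs both copies of `σ_j`. -/
theorem pairTau_trans (a b c : Fin n) :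
    pairTau a b * pairTau b c * pairTau a c = pairTau a b * pairTau b c := by
  rcases eq_or_ne a b with rfl | hab
  · rw [mul_assoc, pairTau_mul_self]
  rcases eq_or_ne b c with rfl | hbc
  · rw [pairTau_self, mul_one, pairTau_mul_self]
  rcases eq_or_ne a c with rfl | hac
  · rw [pairTau_self, mul_one]
  obtain ⟨i, j, p, hij, ha, hb, hb', hc⟩ := exists_perm_triple hab hac hbc
  have h1 : pairTau a b = conjPermT p (tg i) := by
    rw [← pairTau_lo_hi, conjPermT_pairTau, ha, hb]
  have h2 : pairTau b c = conjPermT p (tg j) := by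
    rw [← pairTau_lo_hi, conjPermT_pairTau, hb', hc]
  have h3 : pairTau a c = conjPermT p (sg j * tg i * sg j) := by
    have e1 : adj j (lo i) = lo i := adj_apply_of_ne (by simp [lo]; omega) (by simp [lo]; omega)
    have e2 : adj j (hi i) = hi j :=
      (congrArg (adj j) (Fin.ext hij : hi i = lo j)).trans (adj_apply_lo j)
    rw [← pairTau_lo_hi, ← pairTau_adj, e1, e2, conjPermT_pairTau, ha, hc]
  have hne : i ≠ j := by rintro rfl; omega
  rw [h1, h2, h3, ← map_mul, ← map_mul]
  congr 1
  calc tg i * tg j * (sg j * tg i * sg j) = tg i * (tg j * sg j) * tg i * sg j := by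
        simp only [mul_assoc]
    _ = tg i * (tg j * tg i) * sg j := by rw [tg_sg]; simp only [mul_assoc]
    _ = tg i * tg i * (tg j * sg j) := by rw [← tg_comm hne]; simp only [mul_assoc]
    _ = tg i * tg j := by rw [tg_mul_self, tg_sg]

/-! ### Products of `pairTau` and the equivalence relations that they encode. -/

/-- The product of the elements `pairTau a b` over a list of pairs. -/
def listTau (l : List (Fin n × Fin n)) : T n := (l.map fun x => pairTau x.1 x.2).prod

/-- The equivalence relation generated by a list of pairs. -/
def listSetoid (l : List (Fin n × Fin n)) : Setoid (Fin n) :=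
  Relation.EqvGen.setoid fun a b => (a, b) ∈ l

theorem listSetoid_le {l : List (Fin n × Fin n)} {r : Setoid (Fin n)} :
    listSetoid l ≤ r ↔ ∀ x ∈ l, r x.1 x.2 :=
  ⟨fun h _ hx => h (Relation.EqvGen.rel _ _ hx), fun h => Setoid.eqvGen_le fun a b => h (a, b)⟩

theorem listSetoid_nil : listSetoid ([] : List (Fin n × Fin n)) = ⊥ :=
  le_bot_iff.1 (listSetoid_le.2 (by simp))

theorem listSetoid_cons (x : Fin n × Fin n) (l : List (Fin n × Fin n)) :
    listSetoid (x :: l) = pairSetoid x.1 x.2 ⊔ listSetoid l := by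
  apply le_antisymm
  · rw [listSetoid_le]
    intro y hy
    rcases List.mem_cons.1 hy with rfl | hy
    · exact pairSetoid_le.1 le_sup_left
    · exact listSetoid_le.1 (le_sup_right : listSetoid l ≤ _) y hy
  · exact sup_le (pairSetoid_le.2 (listSetoid_le.1 le_rfl x List.mem_cons_self))
      (listSetoid_le.2 fun y hy => listSetoid_le.1 le_rfl y (List.mem_cons_of_mem _ hy))

theorem toDual_listTau (l : List (Fin n × Fin n)) :
    toDual n (listTau l) = ofSetoid (listSetoid l) := by
  induction l with
  | nil => rw [listSetoid_nil, ofSetoid_bot, listTau, List.map_nil, List.prod_nil, map_one]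
  | cons x l ih =>
    rw [listSetoid_cons, ← ofSetoid_mul, ← ih, ← toDual_pairTau, ← map_mul]
    rfl

theorem commute_pairTau_listTau (a b : Fin n) (l : List (Fin n × Fin n)) :
    Commute (pairTau a b) (listTau l) :=
  Commute.list_prod_right _ _ fun y hy => by
    obtain ⟨x, -, rfl⟩ := List.mem_map.1 hy
    exact pairTau_commute _ _ _ _

theorem listTau_commute (l m : List (Fin n × Fin n)) : Commute (listTau l) (listTau m) :=
  Commute.list_prod_left _ _ fun y hy => by
    obtain ⟨x, -, rfl⟩ := List.mem_map.1 hy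
    exact commute_pairTau_listTau _ _ _

theorem listTau_mul_pairTau_of_mem {l : List (Fin n × Fin n)} {x : Fin n × Fin n} (h : x ∈ l) :
    listTau l * pairTau x.1 x.2 = listTau l := by
  induction l with
  | nil => simp at h
  | cons y l ih =>
    have e : listTau (y :: l) = pairTau y.1 y.2 * listTau l := rfl
    rcases List.mem_cons.1 h with rfl | h
    · rw [e, mul_assoc, ← (commute_pairTau_listTau _ _ l).eq, ← mul_assoc, pairTau_mul_self]
    · rw [e, mul_assoc, ih h]

/-- The pairs absorbed by `listTau l` form an equivalence relation, with `pairTau_trans` behind its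
transitivity, and it contains the pairs of `l`. -/
theorem listTau_mul_pairTau {l : List (Fin n × Fin n)} {a b : Fin n} (h : listSetoid l a b) :
    listTau l * pairTau a b = listTau l := by
  let q : Setoid (Fin n) :=
    { r := fun a b => listTau l * pairTau a b = listTau l
      iseqv :=
        { refl := fun a => by rw [pairTau_self, mul_one]
          symm := fun {a b} h => by rw [pairTau_comm, h]
          trans := fun {a b c} h1 h2 => by
            have := congrArg (listTau l * ·) (pairTau_trans a b c)
            simpa only [← mul_assoc, h1, h2] using this } }
  have : listSetoid l ≤ q := listSetoid_le.2 fun x hx => listTau_mul_pairTau_of_mem hx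
  exact this h

theorem listTau_mul_listTau {l m : List (Fin n × Fin n)} (h : listSetoid m ≤ listSetoid l) :
    listTau l * listTau m = listTau l := by
  induction m with
  | nil => exact mul_one _
  | cons x m ih =>
    rw [listSetoid_cons, sup_le_iff, pairSetoid_le] at h
    change listTau l * (pairTau x.1 x.2 * listTau m) = _
    rw [← mul_assoc, listTau_mul_pairTau h.1, ih h.2]

/-- Each of the two commuting products absorbs the other. -/
theorem listTau_eq {l m : List (Fin n × Fin n)} (h : listSetoid l = listSetoid m) :
    listTau l = listTau m := by
  rw [← listTau_mul_listTau h.ge, (listTau_commute l m).eq, listTau_mul_listTau h.le]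

/-- The transposition of `a` and `p a` is absorbed through `pairTau a (p a)`, and splitting it off
makes the support of `p` smaller. -/
theorem listTau_mul_permT {l : List (Fin n × Fin n)} {p : Equiv.Perm (Fin n)}
    (h : ∀ a, listSetoid l a (p a)) : listTau l * permT n p = listTau l := by
  induction hk : p.support.card using Nat.strong_induction_on generalizing p with
  | _ k ih =>
    by_cases hp : p = 1
    · rw [hp, map_one, mul_one]
    · obtain ⟨a, ha⟩ : ∃ a, p a ≠ a := by
        by_contra hcon
        push Not at hcon
        exact hp (Equiv.ext hcon)
      have e : p = Equiv.swap a (p a) * (Equiv.swap a (p a) * p) := by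
        rw [← mul_assoc, Equiv.swap_mul_self, one_mul]
      have h1 : listTau l * permT n (Equiv.swap a (p a)) = listTau l := by
        rw [← listTau_mul_pairTau (h a), mul_assoc, pairTau_mul_swap]
      rw [e, map_mul, ← mul_assoc, h1]
      refine ih _ (hk ▸ Equiv.Perm.card_support_swap_mul ha) (fun b => ?_) rfl
      exact (listSetoid l).trans (h b) (rel_swap (h a) _)

/-! ### Normal form in `T n` and bijectivity. -/

theorem exists_normal_form (x : T n) :
    ∃ (l : List (Fin n × Fin n)) (p : Equiv.Perm (Fin n)), x = listTau l * permT n p := by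
  have hx : x ∈ Submonoid.closure (Set.range (PresentedMonoid.of (Rel n))) := by
    rw [PresentedMonoid.closure_range_of]
    trivial
  induction hx using Submonoid.closure_induction_right with
  | one => exact ⟨[], 1, by rw [map_one]; rfl⟩
  | mul_right x hx y hy ih =>
    obtain ⟨l, p, rfl⟩ := ih
    obtain ⟨(i | i), rfl⟩ := hy
    · exact ⟨l, p * adj i, by rw [map_mul, permT_adj, mul_assoc]; rfl⟩
    -- Moving `τ_i` to the left across `permT n p` applies `p` to its pair.
    · refine ⟨l ++ [(p (lo i), p (hi i))], p, ?_⟩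
      change _ * tg i = _
      rw [← pairTau_lo_hi, mul_assoc, permT_mul_pairTau]
      simp [listTau, mul_assoc]

theorem toDual_injective (n : ℕ) : Function.Injective (toDual n) := by
  intro x y h
  obtain ⟨l, p, rfl⟩ := exists_normal_form x
  obtain ⟨m, q, rfl⟩ := exists_normal_form y
  rw [map_mul, map_mul, toDual_listTau, toDual_listTau, toDual_permT, toDual_permT,
    ofSetoid_mul_ofPerm_eq] at h
  obtain ⟨h1, h2⟩ := h
  rw [← listTau_eq h1]
  -- The quotient `q * p⁻¹` keeps every point in its class, so the product absorbs it.
  have e : q = (q * p⁻¹) * p := by group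
  rw [e, map_mul, ← mul_assoc, listTau_mul_permT (p := q * p⁻¹)]
  exact fun a => by simpa using h2 (p⁻¹ a)

theorem exists_listSetoid_eq (r : Setoid (Fin n)) : ∃ l, listSetoid l = r := by
  classical
  refine ⟨(Finset.univ.filter fun x : Fin n × Fin n => r x.1 x.2).toList, le_antisymm ?_ ?_⟩
  · exact listSetoid_le.2 fun x hx => by simpa using hx
  · intro a b h
    exact listSetoid_le.1 le_rfl (a, b) (by simpa using h)

theorem toIT_bijective (n : ℕ) : Function.Bijective (toIT n) := by
  refine ⟨fun x y h => toDual_injective n (congrArg (embIT n) h), fun α => ?_⟩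
  obtain ⟨r, p, h⟩ := exists_of_mem_balanced (embIT_mem_balanced α)
  obtain ⟨l, rfl⟩ := exists_listSetoid_eq r
  refine ⟨listTau l * permT n p, embIT_injective n ?_⟩
  rw [h, ← toDual_listTau, ← toDual_permT, ← map_mul]
  rfl

end BrauerType

theorem theorem2 (n : ℕ) :
    (∃ φ : BrauerType.T n ≃* BrauerType.IT n,
      (∀ i : Fin (n - 1),
        φ (PresentedMonoid.of (BrauerType.Rel n) (BrauerType.Gen.sig i)) = BrauerType.s i) ∧
      (∀ i : Fin (n - 1),
        φ (PresentedMonoid.of (BrauerType.Rel n) (BrauerType.Gen.tau i)) = BrauerType.rho i)) ∧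
    BrauerType.IT n ≤ BrauerType.IP n ∧
    (∃ ψ : BrauerType.IP n ≃* BrauerType.DualSymInv (Fin n),
      (∀ (α : BrauerType.IP n) (i j : Fin n),
        (ψ α).rel i j ↔ BrauerType.PartitionMonoid.Conn α.1 (Sum.inl i) (Sum.inr j)) ∧
      IsGreatest (BrauerType.factorizableInverseSubmonoids (BrauerType.DualSymInv (Fin n)))
        (((BrauerType.IT n).comap (BrauerType.IP n).subtype).map ψ.toMonoidHom)) := by
  refine ⟨⟨MulEquiv.ofBijective (BrauerType.toIT n) (BrauerType.toIT_bijective n),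
      fun _ => rfl, fun _ => rfl⟩,
    BrauerType.IT_le_IP n, BrauerType.PartitionMonoid.dualSymInvEquiv n, fun _ _ _ => Iff.rfl, ?_⟩
  rw [BrauerType.map_IT]
  exact BrauerType.DualSymInv.isGreatest_balanced
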